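/- Let $\theta>0$, $0<p<1$ and $\alpha:=\theta\lambda$, where $\lambda$ is the Lebesgue measure on $\mathbb R$. Let $\mathbf N$ be the space of counting measures on $\mathbb R$ (countable sums of measures that take values in $\mathbb N_0=\{0,1,2,\dots\}$), with the smallest $\sigma$-algebra for which all $\mu\mapsto\mu(B)$, $B\subset\mathbb R$ measurable, are measurable, and let $\mathbf N_{\mathrm{lf}}$ be the set of locally finite $\mu\in\mathbf N$. Let $\rho_{p,\alpha}$ be the law on $\mathbf N$ of a Pascal process $\zeta$ with parameters $p$ and $\alpha$: $\zeta(A_1),\dots,\zeta(A_N)$ are independent for pairwise disjoint measurable $A_1,\dots,A_N\subset\mathbb R$, and for every measurable $A\subset\mathbb R$, $$\mathbb P[\zeta(A)=k]=\alpha(A)(\alpha(A)+1)\cdots(\alpha(A)+k-1)\,\frac{p^k}{k!}\,(1-p)^{\alpha(A)},\qquad k\in\mathbb N_0,$$ if $0<\alpha(A)<\infty$, while $\zeta(A)=0$ almost surely if $\alpha(A)=0$, and $\zeta(A)=\infty$ almost surely if $\alpha(A)=\infty$. For $n\ge 1$ let $\mathcal C_n$ be the set of bounded measurable functions $f_n:\mathbb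 R^n\to\mathbb R$ with bounded support, and let $\widetilde{f_n}(x_1,\dots,x_n)=\frac1{n!}\sum_{s\in\mathfrak S_n}f_n(x_{s(1)},\dots,x_{s(n)})$ be the symmetrization of $f_n$. For $\mu=\sum_i\delta_{x_i}\in\mathbf N$ let $\mu^{(k)}=\sum_{i_1,\dots,i_k\text{ pairwise different}}\delta_{(x_{i_1},\dots,x_{i_k})}$ be the $k$-th factorial measure, and for $0\le k\le n$ let $\kappa_{n,k}$ be the kernel from $\mathbb R^k$ to $\mathbb R^{n-k}$ given by $$\kappa_{n,k}(x_1,\dots,x_k,\mathrm d(x_{k+1},\dots,x_n))=(\alpha+\delta_{x_1}+\dots+\delta_{x_{n-1}})(\mathrm dx_n)\cdots(\alpha+\delta_{x_1}+\dots+\delta_{x_k})(\mathrm dx_{k+1}).$$ For $\mu\in\mathbf N_{\mathrm{lf}}$ and $f_n\in\mathcal C_n$ put $$\mathcal M^{p,\alpha}_nf_n(\mu)=\sum_{k=0}^n\binom nk\Bigl(1-\frac1p\Bigr)^{k-n}\iint\widetilde{f_n}(x_1,\dots,x_n)\,\kappa_{n,k}(x_1,\dots,x_k,\mathrm d(x_{k+1},\dots,x_n))\,\mu^{(k)}(\mathrm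 d(x_1,\dots,x_k)),$$ where the inner integral is absent for $k=n$ and the outer integral is absent for $k=0$. Finally, let $\mathcal P_n$ be the set of polynomials of degree at most $n$, i.e. of the functions $\mathbf N_{\mathrm{lf}}\ni\mu\mapsto u_0+\sum_{k=1}^n\int u_k\,\mathrm d\mu^{\otimes k}$ with $u_0\in\mathbb R$ and $u_k\in\mathcal C_k$. Then, for every $n\ge1$ and every $f_n\in\mathcal C_n$, the function $\mu\mapsto\mu^{\otimes n}(f_n)=\int f_n\,\mathrm d\mu^{\otimes n}$ belongs to $L^2(\rho_{p,\alpha})$, and $$\mathcal M^{p,\alpha}_nf_n=\text{orthogonal projection in }L^2(\rho_{p,\alpha})\text{ of }\bigl(\mu\mapsto\mu^{\otimes n}(f_n)\bigr)\text{ onto }\mathcal P_{n-1}^{\perp}$$ holds $\rho_{p,\alpha}$-almost surely. -/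

import Mathlib

open MeasureTheory ProbabilityTheory
open scoped ENNReal Nat

noncomputable section

namespace PascalMeixner

/-! ### Configurations -/

/-- `μ` is a counting measure on the real line: a countable sum of measures which assign a value
in `ℕ` to every measurable set. -/
def IsCounting (μ : Measure ℝ) : Prop :=
  ∃ ν : ℕ → Measure ℝ,
    (∀ i, ∀ B : Set ℝ, MeasurableSet B → ∃ m : ℕ, ν i B = m) ∧ μ = Measure.sum ν

/-- The space of all counting measures on the real line. As a subtype of `Measure ℝ` it carries the
smallest σ-algebra for which all the evaluations `μ ↦ μ B`, `B` measurable, are measurable. -/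
abbrev Config : Type := {μ : Measure ℝ // IsCounting μ}

/-- The index set `{(x, j) : j < μ {x}}`, which enumerates the points of the configuration `μ`,
every point `x` being listed as often as its multiplicity `μ {x}` says. -/
abbrev Points (μ : Measure ℝ) : Type := {q : ℝ × ℕ // (q.2 : ℝ≥0∞) < μ {q.1}}

/-- The `k`-th factorial measure of a counting measure: the sum of the Dirac measures at
`(x_{i_1}, …, x_{i_k})` over all `k`-tuples of pairwise different indices `i_1, …, i_k`, where
`(x_i)` enumerates the points of `μ` with multiplicity. -/
def factorialMeasure (μ : Measure ℝ) (k : ℕ) : Measure (Fin k → ℝ) :=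
  Measure.sum fun e : Fin k ↪ Points μ => Measure.dirac fun i => (e i).1.1

theorem count_fibre {ι : Type*} (x : ι → ℝ) (t : ℝ) :
    Measure.sum (fun i => Measure.dirac (x i)) {t} = (ENat.card {i // x i = t} : ℝ≥0∞) := by
  rw [Measure.sum_apply _ (measurableSet_singleton t)]
  have : ∀ i, Measure.dirac (x i) {t} = Set.indicator {i | x i = t} (fun _ => (1:ℝ≥0∞)) i := by
    intro i
    by_cases h : x i = t <;> simp [h, Set.indicator]
  simp_rw [this]
  rw [← tsum_subtype {i | x i = t}]
  rw [ENNReal.tsum_const]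
  rw [mul_one]; rfl

theorem equivFibre (A : Type*) [Countable A] : 
    Nonempty (A ≃ {j : ℕ // (j : ℝ≥0∞) < (ENat.card A : ℝ≥0∞)}) := by
  rcases finite_or_infinite A with h | h
  · have := Fintype.ofFinite A
    refine ⟨(Fintype.equivFin A).trans (Fin.equivSubtype.trans (Equiv.subtypeEquivRight ?_))⟩
    intro j
    simp [ENat.card_eq_coe_fintype_card]
  · obtain ⟨e⟩ := nonempty_equiv_of_countable (α := A) (β := ℕ)
    refine ⟨e.trans (Equiv.subtypeUnivEquiv ?_).symm⟩
    intro j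
    simp [ENat.card_eq_top_of_infinite]

/-- The factorial measure is given by the usual formula for every enumeration of the points. -/
theorem factorialMeasure_sum_dirac {ι : Type*} [Countable ι] (x : ι → ℝ) (k : ℕ) :
    factorialMeasure (Measure.sum fun i => Measure.dirac (x i)) k =
      Measure.sum fun e : Fin k ↪ ι => Measure.dirac fun j => x (e j) := by
  have key : ∃ E : ι ≃ Points (Measure.sum fun i => Measure.dirac (x i)), ∀ i, (E i).1.1 = x i := by
    have h1 := fun t : ℝ => equivFibre {i // x i = t}
    simp only [← count_fibre x] at h1
    have e := fun t => (h1 t).some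
    let E2 : (Σ t, {j : ℕ // (j : ℝ≥0∞) < (Measure.sum fun i => Measure.dirac (x i)) {t}}) ≃
        Points (Measure.sum fun i => Measure.dirac (x i)) :=
      { toFun := fun s => ⟨(s.1, s.2.1), s.2.2⟩
        invFun := fun q => ⟨q.1.1, q.1.2, q.2⟩
        left_inv := fun s => rfl
        right_inv := fun s => rfl }
    exact ⟨(Equiv.sigmaFiberEquiv x).symm.trans ((Equiv.sigmaCongrRight e).trans E2), fun i => rfl⟩
  obtain ⟨E, hE⟩ := key
  unfold factorialMeasure
  ext s hs
  rw [Measure.sum_apply _ hs, Measure.sum_apply _ hs, ← 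
    (Equiv.embeddingCongr (Equiv.refl (Fin k)) E).tsum_eq]
  simp [hE]

/-! ### The Pascal process -/

/-- `ρ` is the law of a Pascal process with parameters `α` and `p`, as a probability measure on
the space of counting measures. -/
structure IsPascalLaw (α : Measure ℝ) (p : ℝ) (ρ : Measure Config) : Prop where
  isProbabilityMeasure : IsProbabilityMeasure ρ
  indep : ∀ (N : ℕ) (A : Fin N → Set ℝ), (∀ i, MeasurableSet (A i)) →
    Pairwise (fun i j => Disjoint (A i) (A j)) →
    iIndepFun (fun (i : Fin N) (μ : Config) => μ.1 (A i)) ρ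
  negBinomial : ∀ A : Set ℝ, MeasurableSet A → 0 < α A → α A < ∞ → ∀ k : ℕ,
    ρ {μ | μ.1 A = k} = ENNReal.ofReal
      ((∏ i ∈ Finset.range k, ((α A).toReal + i)) * (p ^ k / k !) * (1 - p) ^ (α A).toReal)
  null : ∀ A : Set ℝ, MeasurableSet A → α A = 0 → ∀ᵐ μ ∂ρ, μ.1 A = 0
  infinite : ∀ A : Set ℝ, MeasurableSet A → α A = ∞ → ∀ᵐ μ ∂ρ, μ.1 A = ∞

/-! ### Test functions and polynomials -/

/-- Bounded measurable functions on `ℝⁿ` with bounded support. For `n = 0` these are the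
constants. -/
def IsTest {n : ℕ} (f : (Fin n → ℝ) → ℝ) : Prop :=
  Measurable f ∧ (∃ C : ℝ, ∀ x, |f x| ≤ C) ∧ Bornology.IsBounded (Function.support f)

/-- The monomial `μ ↦ ∫ f dμ^{⊗n}`. -/
def monomial {n : ℕ} (f : (Fin n → ℝ) → ℝ) (μ : Config) : ℝ :=
  ∫ x, f x ∂(Measure.pi fun _ : Fin n => μ.1)

/-- `F` is a polynomial of degree at most `n`, that is
`F μ = u₀ + ∑_{k=1}^n ∫ u_k dμ^{⊗k}` for all locally finite configurations `μ`, with test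
functions `u_k`. (The law of a Pascal process is concentrated on these configurations.) -/
def IsPolynomial (n : ℕ) (F : Config → ℝ) : Prop :=
  ∃ (c : ℝ) (u : (k : ℕ) → (Fin k → ℝ) → ℝ), (∀ k, IsTest (u k)) ∧
    ∀ μ : Config, IsLocallyFiniteMeasure μ.1 →
      F μ = c + ∑ k ∈ Finset.Icc 1 n, monomial (u k) μ

/-- The polynomials of degree at most `n`, as a linear subspace of `L²(ρ)`. -/
def polynomials (ρ : Measure Config) (n : ℕ) : Submodule ℝ (Lp ℝ 2 ρ) :=
  Submodule.span ℝ {G | ∃ F, IsPolynomial n F ∧ G =ᵐ[ρ] F}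

/-! ### The kernels and the explicit formula -/

/-- The symmetrization of a function of `n` variables. -/
def symmetrization {n : ℕ} (f : (Fin n → ℝ) → ℝ) (x : Fin n → ℝ) : ℝ :=
  (n ! : ℝ)⁻¹ * ∑ s : Equiv.Perm (Fin n), f fun i => x (s i)

/-- The kernel `κ_{n+1,n}(x₁, …, x_n, ·) = α + δ_{x₁} + … + δ_{x_n}`. -/
def kappaStep (α : Measure ℝ) (n : ℕ) : Kernel (Fin n → ℝ) ℝ :=
  Kernel.const _ α + ∑ i : Fin n, Kernel.deterministic (fun x => x i) (measurable_pi_apply i)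

theorem kappaStep_apply (α : Measure ℝ) (n : ℕ) (x : Fin n → ℝ) :
    kappaStep α n x = α + ∑ i, Measure.dirac (x i) := by
  simp [kappaStep, Kernel.deterministic_apply]

instance (α : Measure ℝ) [SFinite α] (n : ℕ) : IsSFiniteKernel (kappaStep α n) := by
  unfold kappaStep
  have := Kernel.IsSFiniteKernel.finsetSum
    (κs := fun i : Fin n => Kernel.deterministic (fun x : Fin n → ℝ => x i)
      (measurable_pi_apply i)) Finset.univ (fun i _ => inferInstance)
  infer_instance

theorem measurable_append (k m : ℕ) :
    Measurable fun q : (Fin k → ℝ) × (Fin m → ℝ) => Fin.append q.1 q.2 := by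
  refine measurable_pi_lambda _ fun i => ?_
  refine Fin.addCases (fun j => ?_) (fun j => ?_) i
  · simp only [Fin.append_left]
    fun_prop
  · simp only [Fin.append_right]
    fun_prop

theorem measurable_snoc (m : ℕ) :
    Measurable fun q : (Fin m → ℝ) × ℝ => (Fin.snoc q.1 q.2 : Fin (m + 1) → ℝ) := by
  refine measurable_pi_lambda _ fun i => ?_
  refine Fin.lastCases ?_ (fun j => ?_) i
  · simp only [Fin.snoc_last]
    fun_prop
  · simp only [Fin.snoc_castSucc]
    fun_prop

/-- The kernel `κ_{k+m,k} = κ_{k+1,k} ⊗ ⋯ ⊗ κ_{k+m,k+m-1}` from `ℝᵏ` to `ℝᵐ`, for an s-finite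
measure `α`. For `m = 0` it is the Dirac measure on the one-point space `ℝ⁰`. -/
def kappa (α : Measure ℝ) (k : ℕ) : (m : ℕ) → Kernel (Fin k → ℝ) (Fin m → ℝ)
  | 0 => Kernel.const _ (Measure.dirac Fin.elim0)
  | m + 1 =>
    (kappa α k m ⊗ₖ (kappaStep α (k + m)).comap
        (fun q : (Fin k → ℝ) × (Fin m → ℝ) => Fin.append q.1 q.2) (measurable_append k m)).map
      (fun q : (Fin m → ℝ) × ℝ => (Fin.snoc q.1 q.2 : Fin (m + 1) → ℝ))

instance (α : Measure ℝ) (k m : ℕ) : IsSFiniteKernel (kappa α k m) := by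
  cases m <;> (unfold kappa; infer_instance)

theorem lintegral_kappa_succ (α : Measure ℝ) [SFinite α] (k m : ℕ) (x : Fin k → ℝ)
    {g : (Fin (m + 1) → ℝ) → ℝ≥0∞} (hg : Measurable g) :
    ∫⁻ y, g y ∂(kappa α k (m + 1) x) =
      ∫⁻ y, ∫⁻ z, g (Fin.snoc y z)
        ∂(α + ∑ i, Measure.dirac (x i) + ∑ j, Measure.dirac (y j)) ∂(kappa α k m x) := by
  rw [kappa, Kernel.lintegral_map _ (measurable_snoc m) _ hg,
    Kernel.lintegral_compProd (f := fun q : (Fin m → ℝ) × ℝ => g (Fin.snoc q.1 q.2)) _ _ _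
      (hg.comp (measurable_snoc m))]
  refine lintegral_congr fun y => ?_
  rw [Kernel.comap_apply, kappaStep_apply, Fin.sum_univ_add, add_assoc]
  simp only [Fin.append_left, Fin.append_right]

/-- The point `(x₁, …, x_k, y_{k+1}, …, y_n)` of `ℝⁿ`, for `k ≤ n`. -/
def join {k n : ℕ} (x : Fin k → ℝ) (y : Fin (n - k) → ℝ) (i : Fin n) : ℝ :=
  if h : (i : ℕ) < k then x ⟨i, h⟩ else y ⟨i - k, by omega⟩

/-- The infinite-dimensional Meixner polynomial of degree `n`, given by the explicit formula. -/
def meixner (p : ℝ) (α : Measure ℝ) {n : ℕ} (f : (Fin n → ℝ) → ℝ) (μ : Config) : ℝ :=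
  ∑ k ∈ Finset.range (n + 1), (n.choose k : ℝ) * (1 - 1 / p) ^ ((k : ℤ) - (n : ℤ)) *
    ∫ x : Fin k → ℝ, ∫ y : Fin (n - k) → ℝ, symmetrization f (join x y) ∂(kappa α k (n - k) x)
      ∂(factorialMeasure μ.1 k)

end PascalMeixner

end

/-! The projection is identified by two facts: the Meixner polynomial differs from the monomial by
an element of `polynomials ρ (n - 1)`, and it is orthogonal to that space.

Both start from a finite-dimensional form. If the support of f lies in a box over a set B of finite
α-measure, then almost surely only a finite list of points of μ matters. For symmetric f,
integrating against `kappa` amounts to iterating one operator, `lower`, which integrates out one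
variable against α plus Dirac masses at the other variables (`integral_kappa_family`). Hence
`meixner_eq`: the Meixner polynomial is a finite combination of sums over tuples of distinct points.
Such a sum equals the sum over all tuples up to sums over shorter tuples (`injSum_sub_powSum_mem`),
and the top coefficient is 1. This gives the first fact.

For orthogonality, a monotone class argument and the polynomial moments of the counts reduce to
indicators of rectangles. These depend only on the cell of a finite partition of B to which each
variable belongs, so everything is a function of the independent negative binomial counts N_i, with
parameters a_i and joint weight w satisfying (N_i + 1) w(N + e_i) = p (a_i + N_i) w(N). Let h_i be
the polynomial of degree n obtained by fixing the first variable in cell i. Pascal's rule for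
binomial coefficients gives the raising identity (`meixnerSum_succ`) -(1 - 1/p) M_{n+1}(N) = ∑_i
[(1/p) N_i h_i(N - e_i) - (a_i + N_i) h_i(N)]. Summation by parts (`IsPascalWeight.tsum_erase`)
turns its pairing with g into ∑_i ∑_N (a_i + N_i) w(N) h_i(N) (g(N + e_i) - g(N)). Here (a_i + N_i)
w(N) is again a Pascal weight, with a_i replaced by a_i + 1, and h_i is a Meixner polynomial for
exactly these parameters, because the fixed point acts as an additional atom. Induction on n
applies: each step lowers the degree of g by one, so a g of degree below n is eventually differenced
to 0 (`tsum_meixnerSum_mul_eq_zero`). -/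

noncomputable section

namespace PascalMeixner

/-! ### Sums over tuples of indices -/

/-- The sum of `F` over all `k`-tuples of points with pairwise different indices. -/
def injSum {T X : Type*} [Fintype T] [DecidableEq T] (k : ℕ) (F : (Fin k → X) → ℝ) (v : T → X) :
    ℝ :=
  ∑ e : Fin k ↪ T, F fun i => v (e i)

/-- The sum of `F` over all `k`-tuples of points. -/
def powSum {T X : Type*} [Fintype T] (k : ℕ) (F : (Fin k → X) → ℝ) (v : T → X) : ℝ :=
  ∑ s : Fin k → T, F fun i => v (s i)

theorem injSum_zero {T X : Type*} [Fintype T] [DecidableEq T] (F : (Fin 0 → X) → ℝ) (v : T → X) :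
    injSum 0 F v = F Fin.elim0 := by
  simp only [injSum, Subsingleton.elim _ (Fin.elim0 : Fin 0 → X)]
  simp

theorem powSum_zero {T X : Type*} [Fintype T] (F : (Fin 0 → X) → ℝ) (v : T → X) :
    powSum 0 F v = F Fin.elim0 := by
  simp only [powSum, Subsingleton.elim _ (Fin.elim0 : Fin 0 → X)]
  simp

theorem powSum_succ {T X : Type*} [Fintype T] (k : ℕ) (F : (Fin (k + 1) → X) → ℝ) (v : T → X) :
    powSum (k + 1) F v = ∑ t, powSum k (fun y => F (Fin.cons (v t) y)) v := by
  simp only [powSum]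
  rw [← Fintype.sum_prod_type', ← (Fin.consEquiv fun _ => T).sum_comp]
  refine Finset.sum_congr rfl fun s _ => congrArg F ?_
  funext i
  refine Fin.cases ?_ (fun j => ?_) i <;> simp [Fin.consEquiv]

theorem cons_comp_apply {T X : Type*} {n : ℕ} (v : T → X) (t : T) (e : Fin n → T) :
    (fun i => v ((Fin.cons t e : Fin (n + 1) → T) i)) =
      (Fin.cons (v t) fun i => v (e i) : Fin (n + 1) → X) := by
  funext i
  refine Fin.cases ?_ (fun j => ?_) i <;> simp

theorem injSum_succ_eq {T X : Type*} [Fintype T] [DecidableEq T] (k : ℕ)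
    (F : (Fin (k + 1) → X) → ℝ) (v : T → X) :
    injSum (k + 1) F v = ∑ e : Fin k ↪ T, ∑ t,
      if ∃ j, e j = t then 0 else F (Fin.cons (v t) fun i => v (e i)) := by
  simp only [injSum]
  rw [← (Equiv.embeddingFinSucc k T).symm.sum_comp, Fintype.sum_sigma]
  refine Finset.sum_congr rfl fun e _ => ?_
  simp only [Equiv.coe_embeddingFinSucc_symm, cons_comp_apply]
  have h : ∀ t, (if ∃ j, e j = t then 0 else F (Fin.cons (v t) fun i => v (e i))) =
      if ¬ ∃ j, e j = t then F (Fin.cons (v t) fun i => v (e i)) else 0 := fun t => by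
    split_ifs <;> rfl
  simp only [h]
  rw [← Finset.sum_filter]
  exact (Finset.sum_subtype (p := fun t => t ∉ Set.range e) _ (by simp)
    (fun t => F (Fin.cons (v t) fun i => v (e i)))).symm

/-- Let the first index run freely, then remove the cases in which it coincides with one of the
other indices. By injectivity of the tuple, each coincidence occurs for exactly one j. -/
theorem injSum_succ {T X : Type*} [Fintype T] [DecidableEq T] (k : ℕ)
    (F : (Fin (k + 1) → X) → ℝ) (v : T → X) :
    injSum (k + 1) F v = ∑ t, injSum k (fun y => F (Fin.cons (v t) y)) v -
      injSum k (fun y => ∑ j, F (Fin.cons (y j) y)) v := by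
  rw [injSum_succ_eq]
  simp only [injSum]
  rw [Finset.sum_comm (γ := T), ← Finset.sum_sub_distrib]
  refine Finset.sum_congr rfl fun e _ => ?_
  have h : ∑ j, F (Fin.cons (v (e j)) fun i => v (e i)) =
      ∑ t, if ∃ j, e j = t then F (Fin.cons (v t) fun i => v (e i)) else 0 := by
    rw [← Finset.sum_filter, ← Finset.sum_map Finset.univ e
      (fun t => F (Fin.cons (v t) fun i => v (e i)))]
    congr 1
    ext t
    simp
  rw [h, ← Finset.sum_sub_distrib]
  refine Finset.sum_congr rfl fun t _ => ?_
  split_ifs <;> simp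

theorem injSum_add {T X : Type*} [Fintype T] [DecidableEq T] (k : ℕ) (F G : (Fin k → X) → ℝ)
    (v : T → X) : injSum k (fun y => F y + G y) v = injSum k F v + injSum k G v := by
  simp [injSum, Finset.sum_add_distrib]

theorem injSum_mul {T X : Type*} [Fintype T] [DecidableEq T] (k : ℕ) (c : ℝ) (F : (Fin k → X) → ℝ)
    (v : T → X) : injSum k (fun y => c * F y) v = c * injSum k F v := by
  simp [injSum, Finset.mul_sum]

theorem injSum_sum {T X κ : Type*} [Fintype T] [DecidableEq T] (s : Finset κ) (k : ℕ)
    (F : κ → (Fin k → X) → ℝ) (v : T → X) :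
    injSum k (fun y => ∑ i ∈ s, F i y) v = ∑ i ∈ s, injSum k (F i) v := by
  simp only [injSum]
  rw [Finset.sum_comm]

theorem injSum_equiv {S T X : Type*} [Fintype S] [DecidableEq S] [Fintype T] [DecidableEq T]
    (E : S ≃ T) (k : ℕ) (F : (Fin k → X) → ℝ) (v : T → X) :
    injSum k F (fun s => v (E s)) = injSum k F v := by
  simp only [injSum]
  rw [← (Equiv.embeddingCongr (Equiv.refl (Fin k)) E).sum_comp]
  rfl

theorem powSum_equiv {S T X : Type*} [Fintype S] [Fintype T] (E : S ≃ T) (k : ℕ)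
    (F : (Fin k → X) → ℝ) (v : T → X) : powSum k F (fun s => v (E s)) = powSum k F v := by
  simp only [powSum]
  rw [← (Equiv.arrowCongr (Equiv.refl (Fin k)) E).sum_comp]
  rfl

/-- Splitting off the first point of a tuple of different points. -/
theorem injSum_succ_erase {T X : Type*} [Fintype T] [DecidableEq T] (k : ℕ)
    (F : (Fin (k + 1) → X) → ℝ) (v : T → X) :
    injSum (k + 1) F v =
      ∑ t, injSum k (fun y => F (Fin.cons (v t) y)) fun s : {s // s ≠ t} => v s.1 := by
  rw [injSum_succ_eq, Finset.sum_comm]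
  refine Finset.sum_congr rfl fun t _ => ?_
  simp only [injSum]
  have h : ∀ e : Fin k ↪ T, (if ∃ j, e j = t then 0 else F (Fin.cons (v t) fun i => v (e i))) =
      if ¬ ∃ j, e j = t then F (Fin.cons (v t) fun i => v (e i)) else 0 := fun e => by
    split_ifs <;> rfl
  simp only [h]
  rw [← Finset.sum_filter]
  symm
  refine Finset.sum_bij (fun e _ => e.trans (Function.Embedding.subtype _)) (fun e _ => ?_)
    (fun e _ e' _ h => ?_) (fun e he => ?_) (fun e _ => rfl)
  · simp only [Finset.mem_filter, Finset.mem_univ, true_and, not_exists]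
    exact fun j => (e j).2
  · ext j
    exact DFunLike.congr_fun h j
  · simp only [Finset.mem_filter, Finset.mem_univ, true_and, not_exists] at he
    exact ⟨⟨fun j => ⟨e j, he j⟩, fun i j hij => e.injective (congrArg Subtype.val hij)⟩,
      Finset.mem_univ _, rfl⟩

/-! ### Distinct tuples versus all tuples -/

/-- The map which sends a function of `k` variables to the sums of its values at the tuples of
points of the lists `v`, with the variables identified along `π`. -/
def pullSum (X : Type*) {k j : ℕ} (π : Fin k → Fin j) (h : (Fin k → X) → ℝ)
    (v : Σ M, Fin M → X) : ℝ :=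
  powSum j (fun y => h fun i => y (π i)) v.2

/-- The linear combinations of the `pullSum`s along surjective maps into `Fin j`, `j < n`. -/
def lowerSums (X : Type*) (k n : ℕ) : Submodule ℝ (((Fin k → X) → ℝ) → (Σ M, Fin M → X) → ℝ) :=
  Submodule.span ℝ {Φ | ∃ j < n, ∃ π : Fin k → Fin j, Function.Surjective π ∧ Φ = pullSum X π}

theorem cons_pull_mem {X : Type*} {k n : ℕ} {Φ : ((Fin k → X) → ℝ) → (Σ M, Fin M → X) → ℝ}
    (h : Φ ∈ lowerSums X k n) :
    (fun (h : (Fin (k + 1) → X) → ℝ) v => ∑ t, Φ (fun y => h (Fin.cons (v.2 t) y)) v) ∈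
      lowerSums X (k + 1) (n + 1) := by
  induction h using Submodule.span_induction with
  | mem Φ h =>
    obtain ⟨j, hj, π, hπ, rfl⟩ := h
    refine Submodule.subset_span ⟨j + 1, by omega, Fin.cons 0 fun i => (π i).succ, ?_, ?_⟩
    · intro i
      refine Fin.cases ⟨0, rfl⟩ (fun i => ?_) i
      obtain ⟨l, rfl⟩ := hπ i
      exact ⟨l.succ, rfl⟩
    · funext h v
      simp only [pullSum, powSum_succ]
      refine Finset.sum_congr rfl fun t _ => ?_
      congr 1
      funext y
      congr 1
      funext i
      refine Fin.cases ?_ (fun j => ?_) i <;> simp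
  | zero =>
    convert Submodule.zero_mem _ using 1
    funext h v
    simp
  | add Φ Ψ _ _ h1 h2 =>
    convert Submodule.add_mem _ h1 h2 using 1
    funext h v
    simp [Finset.sum_add_distrib]
  | smul c Φ _ h1 =>
    convert Submodule.smul_mem _ c h1 using 1
    funext h v
    simp [Finset.mul_sum]

/-- Identifying the new variable with an old one adds no summation, so the bound n on the order is
unchanged, in contrast to `cons_pull_mem`. -/
theorem diagonal_pull_mem {X : Type*} {k n : ℕ} (i : Fin k)
    {Φ : ((Fin k → X) → ℝ) → (Σ M, Fin M → X) → ℝ} (h : Φ ∈ lowerSums X k n) :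
    (fun (h : (Fin (k + 1) → X) → ℝ) => Φ fun y => h (Fin.cons (y i) y)) ∈
      lowerSums X (k + 1) n := by
  induction h using Submodule.span_induction with
  | mem Φ h =>
    obtain ⟨j, hj, π, hπ, rfl⟩ := h
    refine Submodule.subset_span ⟨j, hj, Fin.cons (π i) π, ?_, ?_⟩
    · intro l
      obtain ⟨m, rfl⟩ := hπ l
      exact ⟨m.succ, rfl⟩
    · funext h v
      simp only [pullSum]
      congr 1
      funext y
      congr 1
      funext i
      refine Fin.cases ?_ (fun j => ?_) i <;> simp
  | zero => exact Submodule.zero_mem _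
  | add Φ Ψ _ _ h1 h2 => exact Submodule.add_mem _ h1 h2
  | smul c Φ _ h1 => exact Submodule.smul_mem _ c h1

theorem lowerSums_mono (X : Type*) (k : ℕ) {m n : ℕ} (h : m ≤ n) :
    lowerSums X k m ≤ lowerSums X k n :=
  Submodule.span_mono fun _ ⟨j, hj, hΦ⟩ => ⟨j, hj.trans_le h, hΦ⟩

/-- A sum over tuples of different points is the sum over all tuples up to sums over shorter
tuples. -/
theorem injSum_sub_powSum_mem (X : Type*) (k : ℕ) :
    (fun (h : (Fin k → X) → ℝ) (v : Σ M, Fin M → X) => injSum k h v.2 - powSum k h v.2) ∈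
      lowerSums X k k := by
  induction k with
  | zero =>
    convert Submodule.zero_mem _ using 1
    funext h v
    simp [injSum_zero, powSum_zero]
  | succ k ih =>
    have hp : (fun (h : (Fin k → X) → ℝ) (v : Σ M, Fin M → X) => powSum k h v.2) ∈
        lowerSums X k (k + 1) :=
      Submodule.subset_span ⟨k, by omega, id, Function.surjective_id, rfl⟩
    have hi : (fun (h : (Fin k → X) → ℝ) (v : Σ M, Fin M → X) => injSum k h v.2) ∈
        lowerSums X k (k + 1) := by
      convert Submodule.add_mem _ (lowerSums_mono X k (Nat.le_succ k) ih) hp using 1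
      funext h v
      simp
    -- By `injSum_succ`, the difference at k + 1 is the difference at k under one more free
    -- summation, minus k diagonal sums over k-tuples of distinct points. The former has order at
    -- most k by induction, the latter by `hi`.
    convert Submodule.sub_mem _ (cons_pull_mem ih)
      (Submodule.sum_mem _ fun i (_ : i ∈ Finset.univ) => diagonal_pull_mem i hi) using 1
    funext h v
    rw [injSum_succ, powSum_succ]
    simp only [Pi.sub_apply, Finset.sum_apply, injSum_sum, Finset.sum_sub_distrib]
    ring

/-! ### Occupation numbers of finitely many cells -/

/-- `injSum` as a function of the numbers `N i` of points of the type `i`. -/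
def facSum {ι : Type*} [Fintype ι] [DecidableEq ι] (k : ℕ) (F : (Fin k → ι) → ℝ) (N : ι → ℕ) : ℝ :=
  injSum k F (Sigma.fst : (Σ i, Fin (N i)) → ι)

/-- `powSum` as a function of the numbers `N i` of points of the type `i`. -/
def monSum {ι : Type*} [Fintype ι] (k : ℕ) (F : (Fin k → ι) → ℝ) (N : ι → ℕ) : ℝ :=
  powSum k F (Sigma.fst : (Σ i, Fin (N i)) → ι)

theorem exists_equiv_sigma_fin {T ι : Type*} [Fintype T] [DecidableEq ι] (v : T → ι) (N : ι → ℕ)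
    (hN : ∀ i, Fintype.card {t // v t = i} = N i) :
    ∃ E : T ≃ (Σ i, Fin (N i)), ∀ t, (E t).1 = v t :=
  ⟨(Equiv.sigmaFiberEquiv v).symm.trans
    (Equiv.sigmaCongrRight fun i => Fintype.equivFinOfCardEq (hN i)), fun _ => rfl⟩

theorem injSum_eq_facSum {T ι : Type*} [Fintype T] [DecidableEq T] [Fintype ι] [DecidableEq ι]
    (k : ℕ) (F : (Fin k → ι) → ℝ) (v : T → ι) (N : ι → ℕ)
    (hN : ∀ i, Fintype.card {t // v t = i} = N i) : injSum k F v = facSum k F N := by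
  obtain ⟨E, hE⟩ := exists_equiv_sigma_fin v N hN
  rw [facSum, ← injSum_equiv E]
  simp only [hE]

theorem powSum_eq_monSum {T ι : Type*} [Fintype T] [Fintype ι] [DecidableEq ι]
    (k : ℕ) (F : (Fin k → ι) → ℝ) (v : T → ι) (N : ι → ℕ)
    (hN : ∀ i, Fintype.card {t // v t = i} = N i) : powSum k F v = monSum k F N := by
  obtain ⟨E, hE⟩ := exists_equiv_sigma_fin v N hN
  rw [monSum, ← powSum_equiv E]
  simp only [hE]

theorem card_fibre_sigma_fst_erase {ι : Type*} [Fintype ι] [DecidableEq ι] (N : ι → ℕ)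
    (t : Σ i, Fin (N i)) (j : ι) :
    Fintype.card {s : {s // s ≠ t} // s.1.1 = j} = (N - Pi.single t.1 1 : ι → ℕ) j := by
  have h1 : Fintype.card {s : {s // s ≠ t} // s.1.1 = j} =
      ((Finset.univ.filter fun s : Σ i, Fin (N i) => s.1 = j).erase t).card := by
    rw [Fintype.card_congr (Equiv.subtypeSubtypeEquivSubtypeInter (fun s => s ≠ t)
      (fun s : Σ i, Fin (N i) => s.1 = j)), Fintype.card_subtype]
    congr 1
    ext s
    simp
  have h2 : (Finset.univ.filter fun s : Σ i, Fin (N i) => s.1 = j).card = N j := by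
    rw [← Fintype.card_subtype, ← Fintype.card_fin (N j)]
    exact Fintype.card_congr (Equiv.sigmaSubtype j)
  rw [h1]
  by_cases h : t.1 = j
  · rw [Finset.card_erase_of_mem (by simp [h]), h2, ← h]
    simp
  · rw [Finset.erase_eq_of_notMem (by simp [h]), h2]
    simp [Pi.single_eq_of_ne (Ne.symm h)]

/-- The first point is one of the N i points of some type i, and the others come from what remains.
The truncated subtraction is harmless, since for N i = 0 the factor N i kills the term. -/
theorem facSum_succ_erase {ι : Type*} [Fintype ι] [DecidableEq ι] (k : ℕ)
    (F : (Fin (k + 1) → ι) → ℝ) (N : ι → ℕ) :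
    facSum (k + 1) F N =
      ∑ i, (N i : ℝ) * facSum k (fun y => F (Fin.cons i y)) (N - Pi.single i 1) := by
  rw [facSum, injSum_succ_erase, Fintype.sum_sigma]
  refine Finset.sum_congr rfl fun i _ => ?_
  rw [Finset.sum_congr rfl fun t _ => injSum_eq_facSum k _ _ _
    (card_fibre_sigma_fst_erase N ⟨i, t⟩)]
  simp only [Finset.sum_const, Finset.card_univ, Fintype.card_fin, nsmul_eq_mul]

theorem sum_mul_facSum_cons {ι : Type*} [Fintype ι] [DecidableEq ι] (k : ℕ)
    (F : (Fin (k + 1) → ι) → ℝ) (N : ι → ℕ) :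
    ∑ i, (N i : ℝ) * facSum k (fun y => F (Fin.cons i y)) N =
      facSum (k + 1) F N + facSum k (fun y => ∑ j, F (Fin.cons (y j) y)) N := by
  simp only [facSum]
  rw [injSum_succ, Fintype.sum_sigma]
  simp

theorem monSum_succ {ι : Type*} [Fintype ι] (k : ℕ) (F : (Fin (k + 1) → ι) → ℝ) (N : ι → ℕ) :
    monSum (k + 1) F N = ∑ i, (N i : ℝ) * monSum k (fun y => F (Fin.cons i y)) N := by
  simp only [monSum]
  rw [powSum_succ, Fintype.sum_sigma]
  simp

/-! ### Degree and growth of functions of the occupation numbers -/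

/-- The effect of adding a point of the type `i`. -/
def addPoint {ι : Type*} [DecidableEq ι] (i : ι) (g : (ι → ℕ) → ℝ) (N : ι → ℕ) : ℝ :=
  g (N + Pi.single i 1) - g N

/-- All differences of order `n` vanish. -/
def DegLT {ι : Type*} [DecidableEq ι] : ℕ → ((ι → ℕ) → ℝ) → Prop
  | 0, g => g = 0
  | n + 1, g => ∀ i, DegLT n (addPoint i g)

namespace DegLT
variable {ι : Type*} [DecidableEq ι]

theorem zero (n : ℕ) : DegLT n (0 : (ι → ℕ) → ℝ) := by
  induction n with
  | zero => rfl
  | succ n ih =>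
    intro i
    convert ih using 1
    funext N
    simp [addPoint]

theorem add {n : ℕ} {g h : (ι → ℕ) → ℝ} (hg : DegLT n g) (hh : DegLT n h) : DegLT n (g + h) := by
  induction n generalizing g h with
  | zero => rw [DegLT] at *; simp [hg, hh]
  | succ n ih =>
    intro i
    convert ih (hg i) (hh i) using 1
    funext N
    simp only [addPoint, Pi.add_apply]
    ring

theorem sum {κ : Type*} {n : ℕ} (s : Finset κ) {g : κ → (ι → ℕ) → ℝ} (hg : ∀ i, DegLT n (g i)) :
    DegLT n (∑ i ∈ s, g i) :=
  Finset.sum_induction _ _ (fun _ _ => add) (zero n) fun i _ => hg i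

theorem shift {n : ℕ} {g : (ι → ℕ) → ℝ} (hg : DegLT n g) (i : ι) :
    DegLT n fun N => g (N + Pi.single i 1) := by
  induction n generalizing g with
  | zero => rw [DegLT] at *; simp only [hg]; rfl
  | succ n ih =>
    intro j
    convert ih (hg j) using 1
    funext N
    simp only [addPoint, add_right_comm]

/-- Discrete product rule: the difference of N_i g in direction j is N_i times the difference of g,
plus the shifted g when i = j. -/
theorem coord_mul {n : ℕ} {g : (ι → ℕ) → ℝ} (hg : DegLT n g) (i : ι) :
    DegLT (n + 1) fun N => (N i : ℝ) * g N := by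
  induction n generalizing g with
  | zero =>
    rw [DegLT] at hg
    have h : (fun N : ι → ℕ => (N i : ℝ) * g N) = 0 := by
      funext N
      simp [hg]
    rw [h]
    exact zero 1
  | succ n ih =>
    intro j
    have h2 : DegLT (n + 1) (if i = j then fun N => g (N + Pi.single j 1) else 0) := by
      split_ifs
      · exact hg.shift j
      · exact zero _
    convert (ih (hg j)).add h2 using 1
    funext N
    by_cases h : i = j
    · subst h
      simp [addPoint]
      ring
    · simp [addPoint, h]
      ring

theorem succ {n : ℕ} {g : (ι → ℕ) → ℝ} (hg : DegLT n g) : DegLT (n + 1) g := by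
  induction n generalizing g with
  | zero => rw [DegLT] at hg; rw [hg]; exact zero 1
  | succ n ih => exact fun i => ih (hg i)

theorem mono {m n : ℕ} (h : m ≤ n) {g : (ι → ℕ) → ℝ} (hg : DegLT m g) : DegLT n g := by
  induction h with
  | refl => exact hg
  | step _ ih => exact ih.succ

end DegLT

theorem degLT_monSum {ι : Type*} [Fintype ι] [DecidableEq ι] (m : ℕ) (F : (Fin m → ι) → ℝ) :
    DegLT (m + 1) (monSum m F) := by
  induction m with
  | zero =>
    intro i
    simp only [DegLT]
    funext N
    simp [addPoint, monSum, powSum_zero]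
  | succ m ih =>
    convert DegLT.sum Finset.univ fun i => (ih fun y => F (Fin.cons i y)).coord_mul i using 1
    funext N
    simp [monSum_succ]

/-- `g` is bounded by a polynomial. -/
def Grow {ι : Type*} [Fintype ι] (g : (ι → ℕ) → ℝ) : Prop :=
  ∃ (C : ℝ) (d : ℕ), ∀ N, |g N| ≤ C * (1 + ∑ i, (N i : ℝ)) ^ d

namespace Grow
variable {ι : Type*} [Fintype ι]

theorem one_le (N : ι → ℕ) : 1 ≤ 1 + ∑ i, (N i : ℝ) :=
  le_add_of_nonneg_right (Finset.sum_nonneg fun _ _ => Nat.cast_nonneg _)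

theorem exists_nonneg {g : (ι → ℕ) → ℝ} (hg : Grow g) :
    ∃ (C : ℝ) (d : ℕ), 0 ≤ C ∧ ∀ N, |g N| ≤ C * (1 + ∑ i, (N i : ℝ)) ^ d := by
  obtain ⟨C, d, h⟩ := hg
  refine ⟨|C|, d, abs_nonneg C, fun N => (h N).trans ?_⟩
  have := one_le N
  gcongr
  exact le_abs_self C

theorem const (c : ℝ) : Grow fun _ : ι → ℕ => c := ⟨|c|, 0, fun N => by simp⟩

theorem coord (i : ι) : Grow fun N : ι → ℕ => (N i : ℝ) := by
  refine ⟨1, 1, fun N => ?_⟩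
  have : (N i : ℝ) ≤ ∑ i, (N i : ℝ) :=
    Finset.single_le_sum (f := fun i => (N i : ℝ)) (fun _ _ => Nat.cast_nonneg _)
      (Finset.mem_univ i)
  rw [abs_of_nonneg (Nat.cast_nonneg _)]
  linarith

theorem mul {g h : (ι → ℕ) → ℝ} (hg : Grow g) (hh : Grow h) : Grow fun N => g N * h N := by
  obtain ⟨C, d, hC, hg⟩ := hg.exists_nonneg
  obtain ⟨D, e, hD, hh⟩ := hh.exists_nonneg
  refine ⟨C * D, d + e, fun N => ?_⟩
  rw [abs_mul, pow_add, mul_mul_mul_comm]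
  have := one_le N
  exact mul_le_mul (hg N) (hh N) (abs_nonneg _) (by positivity)

theorem add {g h : (ι → ℕ) → ℝ} (hg : Grow g) (hh : Grow h) : Grow fun N => g N + h N := by
  obtain ⟨C, d, hC, hg⟩ := hg.exists_nonneg
  obtain ⟨D, e, hD, hh⟩ := hh.exists_nonneg
  refine ⟨C + D, d + e, fun N => (abs_add_le _ _).trans ?_⟩
  have := one_le N
  rw [add_mul]
  refine add_le_add ((hg N).trans ?_) ((hh N).trans ?_)
  · gcongr
    omega
  · gcongr
    omega

theorem sum {κ : Type*} (s : Finset κ) {g : κ → (ι → ℕ) → ℝ} (hg : ∀ i, Grow (g i)) :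
    Grow fun N => ∑ i ∈ s, g i N := by
  classical
  induction s using Finset.induction_on with
  | empty => simpa using const 0
  | insert a s ha ih =>
    simp only [Finset.sum_insert ha]
    exact (hg a).add ih

/-- If the total grows by at most one, then 1 + total at most doubles; this is the source of the
factor 2 ^ d. -/
theorem comp {g : (ι → ℕ) → ℝ} (hg : Grow g) (u : (ι → ℕ) → ι → ℕ)
    (hu : ∀ N, ∑ i, u N i ≤ ∑ i, N i + 1) : Grow fun N => g (u N) := by
  obtain ⟨C, d, hC, hg⟩ := hg.exists_nonneg
  refine ⟨C * 2 ^ d, d, fun N => (hg _).trans ?_⟩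
  rw [mul_assoc, ← mul_pow]
  have h1 := one_le N
  have h2 := one_le (u N)
  have h3 : ∑ i, (u N i : ℝ) ≤ ∑ i, (N i : ℝ) + 1 := by exact_mod_cast hu N
  gcongr
  linarith

theorem shift [DecidableEq ι] {g : (ι → ℕ) → ℝ} (hg : Grow g) (i : ι) :
    Grow fun N => g (N + Pi.single i 1) :=
  hg.comp _ fun N => by simp [Finset.sum_add_distrib]

theorem unshift [DecidableEq ι] {g : (ι → ℕ) → ℝ} (hg : Grow g) (i : ι) :
    Grow fun N => g (N - Pi.single i 1) :=
  hg.comp _ fun _ => (Finset.sum_le_sum fun _ _ => Nat.sub_le _ _).trans (Nat.le_succ _)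

end Grow

theorem grow_monSum {ι : Type*} [Fintype ι] (m : ℕ) (F : (Fin m → ι) → ℝ) :
    Grow (monSum m F) := by
  induction m with
  | zero =>
    have h : monSum 0 F = fun _ => F Fin.elim0 := funext fun N => powSum_zero _ _
    rw [h]
    exact Grow.const _
  | succ m ih =>
    convert Grow.sum Finset.univ fun i => (Grow.coord i).mul (ih fun y => F (Fin.cons i y)) using 1
    funext N
    rw [monSum_succ]

theorem grow_facSum {ι : Type*} [Fintype ι] [DecidableEq ι] (m : ℕ) (F : (Fin m → ι) → ℝ) :
    Grow (facSum m F) := by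
  induction m with
  | zero =>
    have h : facSum 0 F = fun _ => F Fin.elim0 := funext fun N => injSum_zero _ _
    rw [h]
    exact Grow.const _
  | succ m ih =>
    convert Grow.sum Finset.univ fun i =>
      (Grow.coord i).mul ((ih fun y => F (Fin.cons i y)).unshift i) using 1
    funext N
    rw [facSum_succ_erase]

/-! ### Negative binomial weights -/

/-- The recursion for the weights of independent negative binomial random variables with
parameters `a i` and `p`, together with the existence of all moments. -/
structure IsPascalWeight {ι : Type*} [Fintype ι] [DecidableEq ι] (p : ℝ) (a : ι → ℝ)
    (w : (ι → ℕ) → ℝ) : Prop where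
  rec_add_single : ∀ N i, ((N i : ℝ) + 1) * w (N + Pi.single i 1) = p * ((a i + N i) * w N)
  summable_moment : ∀ d : ℕ, Summable fun N => |w N| * (1 + ∑ i, (N i : ℝ)) ^ d

namespace IsPascalWeight
variable {ι : Type*} [Fintype ι] [DecidableEq ι] {p : ℝ} {a : ι → ℝ} {w : (ι → ℕ) → ℝ}

theorem summable (hw : IsPascalWeight p a w) {g : (ι → ℕ) → ℝ} (hg : Grow g) :
    Summable fun N => w N * g N := by
  obtain ⟨C, d, hC, hg⟩ := hg.exists_nonneg
  refine Summable.of_norm_bounded ((hw.summable_moment d).mul_left C) fun N => ?_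
  rw [Real.norm_eq_abs, abs_mul, mul_left_comm]
  exact mul_le_mul_of_nonneg_left (hg N) (abs_nonneg _)

/-- The weights with one parameter raised by one. -/
theorem raise (hw : IsPascalWeight p a w) (i : ι) :
    IsPascalWeight p (a + Pi.single i 1) fun N => (a i + N i) * w N where
  rec_add_single N j := by
    have h := hw.rec_add_single N j
    by_cases hij : j = i
    · subst hij
      simp only [Pi.add_apply, Pi.single_eq_same, Nat.cast_add, Nat.cast_one]
      linear_combination (a j + (N j + 1)) * h
    · simp only [Pi.add_apply, Pi.single_eq_of_ne hij, Pi.single_eq_of_ne (Ne.symm hij), add_zero]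
      linear_combination (a i + N i) * h
  summable_moment d := by
    obtain ⟨C, e, hC, h⟩ := ((Grow.const (a i)).add (Grow.coord i)).exists_nonneg
    refine Summable.of_nonneg_of_le (fun N => ?_) (fun N => ?_)
      ((hw.summable_moment (e + d)).mul_left C)
    · have := Grow.one_le N
      positivity
    · have := Grow.one_le N
      rw [abs_mul, pow_add]
      calc |a i + N i| * |w N| * (1 + ∑ i, (N i : ℝ)) ^ d
          ≤ (C * (1 + ∑ i, (N i : ℝ)) ^ e) * |w N| * (1 + ∑ i, (N i : ℝ)) ^ d := by
            gcongr
            exact h N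
        _ = _ := by ring

/-- Removing a point versus adding a point. -/
theorem tsum_erase (hw : IsPascalWeight p a w) (i : ι) (u ψ : (ι → ℕ) → ℝ) :
    ∑' N, w N * ((N i : ℝ) * u (N - Pi.single i 1) * ψ N) =
      p * ∑' N, (a i + N i) * w N * (u N * ψ (N + Pi.single i 1)) := by
  have hinj : Function.Injective fun N : ι → ℕ => N + Pi.single i 1 := add_left_injective _
  -- Substitute N + e_i for N: the terms with N i = 0 vanish, so the support lies in the range of
  -- the shift. Reindexing along an injection needs no summability.
  rw [← hinj.tsum_eq, ← tsum_mul_left]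
  · refine tsum_congr fun N => ?_
    simp only [Pi.add_apply, Pi.single_eq_same, add_tsub_cancel_right, Nat.cast_add, Nat.cast_one]
    linear_combination u N * ψ (N + Pi.single i 1) * hw.rec_add_single N i
  · intro N hN
    have h : N i ≠ 0 := fun h => hN (by simp [h])
    refine ⟨N - Pi.single i 1, ?_⟩
    funext j
    by_cases hj : j = i
    · subst hj
      simp
      omega
    · simp [Pi.single_eq_of_ne hj]

end IsPascalWeight

/-! ### Orthogonality for finitely many cells -/

/-- The Meixner polynomial built from the family of functions `G k` of `k` variables. -/
def meixnerSum {ι : Type*} [Fintype ι] [DecidableEq ι] (p : ℝ) (n : ℕ)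
    (G : (k : ℕ) → (Fin k → ι) → ℝ) (N : ι → ℕ) : ℝ :=
  ∑ k ∈ Finset.range (n + 1), (n.choose k : ℝ) * (1 - 1 / p) ^ ((k : ℤ) - (n : ℤ)) *
    facSum k (G k) N

theorem grow_meixnerSum {ι : Type*} [Fintype ι] [DecidableEq ι] (p : ℝ) (n : ℕ)
    (G : (k : ℕ) → (Fin k → ι) → ℝ) : Grow (meixnerSum p n G) :=
  Grow.sum _ fun k => (Grow.const _).mul (grow_facSum k (G k))

/-! ### Families of functions linked by integrating out variables, and the raising identity -/

/-- Every function of the family is symmetric, for at most `n` variables. -/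
def SymmFamily {X : Type*} (n : ℕ) (G : (k : ℕ) → (Fin k → X) → ℝ) : Prop :=
  ∀ k ≤ n, ∀ (σ : Equiv.Perm (Fin k)) (y : Fin k → X), (G k fun i => y (σ i)) = G k y

theorem SymmFamily.cons {X : Type*} {n : ℕ} {G : (k : ℕ) → (Fin k → X) → ℝ}
    (hG : SymmFamily (n + 1) G) (x : X) : SymmFamily n fun k y => G (k + 1) (Fin.cons x y) := by
  intro k hk σ y
  change G (k + 1) _ = G (k + 1) _
  rw [← hG (k + 1) (by omega) (Equiv.Perm.decomposeFin.symm (0, σ)) (Fin.cons x y)]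
  congr 1
  funext i
  refine Fin.cases ?_ (fun j => ?_) i <;> simp [Equiv.Perm.decomposeFin_symm_apply_succ]

theorem SymmFamily.swap {X : Type*} {n k : ℕ} {G : (k : ℕ) → (Fin k → X) → ℝ}
    (hG : SymmFamily n G) (hk : k + 2 ≤ n) (x x' : X) (y : Fin k → X) :
    G (k + 2) (Fin.cons x (Fin.cons x' y : Fin (k + 1) → X)) =
      G (k + 2) (Fin.cons x' (Fin.cons x y : Fin (k + 1) → X)) := by
  rw [← hG (k + 2) hk (Equiv.swap 0 1)]
  congr 1
  funext i
  refine Fin.cases ?_ (fun j => Fin.cases ?_ (fun l => ?_) j) i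
  · simp
  · simp
  · rw [Equiv.swap_apply_of_ne_of_ne (Fin.succ_ne_zero _)
      (by simp [Fin.ext_iff])]
    simp

/-- Every function of the family arises from the following one by integrating out a variable. -/
def LoweringFamily {ι : Type*} [Fintype ι] (a : ι → ℝ) (n : ℕ)
    (G : (k : ℕ) → (Fin k → ι) → ℝ) : Prop :=
  ∀ k < n, ∀ y, G k y = ∑ i, a i * G (k + 1) (Fin.cons i y) + ∑ j, G (k + 1) (Fin.cons (y j) y)

/-- The frozen variable i is one of the arguments at which `lower` puts a Dirac mass. Moved into the
measure, this mass raises a_i by one, just as `IsPascalWeight.raise` does. Symmetry is needed to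
bring the frozen variable back to the front. -/
theorem LoweringFamily.cons {ι : Type*} [Fintype ι] [DecidableEq ι] {a : ι → ℝ} {n : ℕ}
    {G : (k : ℕ) → (Fin k → ι) → ℝ} (hG : LoweringFamily a (n + 1) G) (hs : SymmFamily (n + 1) G)
    (i : ι) : LoweringFamily (a + Pi.single i 1) n fun k y => G (k + 1) (Fin.cons i y) := by
  intro k hk y
  change G (k + 1) _ = _
  rw [hG (k + 1) (by omega), Fin.sum_univ_succ]
  simp only [Fin.cons_zero, Fin.cons_succ, Pi.add_apply, add_mul, Finset.sum_add_distrib]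
  have h : ∑ l, (Pi.single i (1 : ℝ) : ι → ℝ) l * G (k + 2) (Fin.cons i (Fin.cons l y)) =
      G (k + 2) (Fin.cons i (Fin.cons i y)) := by
    rw [Finset.sum_eq_single i (fun l _ hl => by simp [Pi.single_eq_of_ne hl]) (by simp)]
    simp
  rw [h, ← add_assoc]
  congr 2
  · exact Finset.sum_congr rfl fun l _ => by rw [hs.swap (by omega) i]
  · exact funext fun j => by rw [hs.swap (by omega) i]

/-- Pascal's rule for the binomial coefficients, in the form that exhibits the polynomial of degree
n + 1 through pairs of consecutive factorial sums. -/
theorem sum_choose_succ_mul_zpow {q : ℝ} (hq : q ≠ 0) (n : ℕ) (I : ℕ → ℝ) :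
    q * ∑ k ∈ Finset.range (n + 1 + 1), ((n + 1).choose k : ℝ) *
        q ^ ((k : ℤ) - ((n + 1 : ℕ) : ℤ)) * I k =
      ∑ k ∈ Finset.range (n + 1), (n.choose k : ℝ) * q ^ ((k : ℤ) - (n : ℤ)) *
        (q * I (k + 1) + I k) := by
  have h1 : ∀ k : ℕ, q * q ^ ((k : ℤ) - ((n + 1 : ℕ) : ℤ)) = q ^ ((k : ℤ) - (n : ℤ)) := fun k => by
    rw [← zpow_one_add₀ hq]
    congr 1
    push_cast
    ring
  have h2 : ∀ k : ℕ, q * q ^ ((k : ℤ) - (n : ℤ)) = q ^ (((k + 1 : ℕ) : ℤ) - (n : ℤ)) := fun k => by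
    rw [← zpow_one_add₀ hq]
    congr 1
    push_cast
    ring
  have h3 : ∑ k ∈ Finset.range (n + 1), (n.choose k : ℝ) * q ^ ((k : ℤ) - (n : ℤ)) * I k =
      ∑ k ∈ Finset.range (n + 1), (n.choose (k + 1) : ℝ) * q ^ (((k + 1 : ℕ) : ℤ) - (n : ℤ)) *
        I (k + 1) + q ^ (((0 : ℕ) : ℤ) - (n : ℤ)) * I 0 := by
    have := Finset.sum_range_succ (fun k => (n.choose k : ℝ) * q ^ ((k : ℤ) - (n : ℤ)) * I k) (n + 1)
    rw [Nat.choose_succ_self, Nat.cast_zero, zero_mul, zero_mul, add_zero] at this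
    rw [← this, Finset.sum_range_succ']
    simp
  simp only [mul_add, Finset.sum_add_distrib]
  rw [h3, Finset.mul_sum, Finset.sum_range_succ', ← add_assoc, ← Finset.sum_add_distrib]
  congr 1
  · refine Finset.sum_congr rfl fun k _ => ?_
    rw [Nat.choose_succ_succ, ← h2, Nat.cast_add]
    have := h1 (k + 1)
    rw [← h2] at this
    linear_combination ((n.choose k : ℝ) + n.choose (k + 1)) * I (k + 1) * this
  · have := h1 0
    simp only [Nat.choose_zero_right, Nat.cast_one, one_mul]
    linear_combination I 0 * this

/-- The Meixner polynomials are generated by the raising operator. -/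
theorem meixnerSum_succ {ι : Type*} [Fintype ι] [DecidableEq ι] {p : ℝ} {a : ι → ℝ} {n : ℕ}
    (hp0 : 0 < p) (hp1 : p < 1) {G : (k : ℕ) → (Fin k → ι) → ℝ}
    (hG : LoweringFamily a (n + 1) G) (N : ι → ℕ) :
    -(1 - 1 / p) * meixnerSum p (n + 1) G N =
      ∑ i, (1 / p * ((N i : ℝ) *
          meixnerSum p n (fun k y => G (k + 1) (Fin.cons i y)) (N - Pi.single i 1)) -
        (a i + N i) * meixnerSum p n (fun k y => G (k + 1) (Fin.cons i y)) N) := by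
  have hq : 1 - 1 / p ≠ 0 := by
    have : 1 < 1 / p := by rw [lt_div_iff₀ hp0]; linarith
    linarith
  rw [neg_mul, meixnerSum, sum_choose_succ_mul_zpow hq n fun k => facSum k (G k) N]
  simp only [meixnerSum, Finset.mul_sum, ← Finset.sum_sub_distrib]
  rw [Finset.sum_comm, ← Finset.sum_neg_distrib]
  refine Finset.sum_congr rfl fun k hk => ?_
  have h1 := facSum_succ_erase k (G (k + 1)) N
  have h2 := sum_mul_facSum_cons k (G (k + 1)) N
  have h3 : facSum k (G k) N = ∑ i, a i * facSum k (fun y => G (k + 1) (Fin.cons i y)) N +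
      facSum k (fun y => ∑ j, G (k + 1) (Fin.cons (y j) y)) N := by
    have : G k = fun y => ∑ i, a i * G (k + 1) (Fin.cons i y) +
        ∑ j, G (k + 1) (Fin.cons (y j) y) := funext (hG k (Finset.mem_range.1 hk))
    rw [this]
    simp only [facSum, injSum_add, injSum_sum Finset.univ k fun i y => a i * G (k + 1)
      (Fin.cons i y), injSum_mul]
  -- A new point drawn from α + μ either comes from α, coincides with one of the k points, or is a
  -- further point of μ. By the lowering relation, the first two cases together give G k.
  have h4 : ∑ i, (a i + N i) * facSum k (fun y => G (k + 1) (Fin.cons i y)) N =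
      facSum k (G k) N + facSum (k + 1) (G (k + 1)) N := by
    simp only [add_mul, Finset.sum_add_distrib]
    linear_combination h2 - h3
  set c : ℝ := (n.choose k : ℝ) * (1 - 1 / p) ^ ((k : ℤ) - (n : ℤ))
  calc -(c * ((1 - 1 / p) * facSum (k + 1) (G (k + 1)) N + facSum k (G k) N))
      = c * (1 / p) * facSum (k + 1) (G (k + 1)) N -
          c * (facSum k (G k) N + facSum (k + 1) (G (k + 1)) N) := by ring
    _ = _ := by
      rw [← h4, h1, Finset.mul_sum, Finset.mul_sum, ← Finset.sum_sub_distrib]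
      exact Finset.sum_congr rfl fun i _ => by ring

/-- The Meixner polynomial of degree `n` is orthogonal to the polynomials of smaller degree. -/
theorem tsum_meixnerSum_mul_eq_zero {ι : Type*} [Fintype ι] [DecidableEq ι] {p : ℝ} (hp0 : 0 < p)
    (hp1 : p < 1) (n : ℕ) {a : ι → ℝ} {w : (ι → ℕ) → ℝ} (hw : IsPascalWeight p a w)
    {G : (k : ℕ) → (Fin k → ι) → ℝ} (hs : SymmFamily n G) (hG : LoweringFamily a n G)
    {g : (ι → ℕ) → ℝ} (hg : Grow g) (hd : DegLT n g) :
    ∑' N, w N * (meixnerSum p n G N * g N) = 0 := by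
  induction n generalizing a w G g with
  | zero =>
    rw [DegLT] at hd
    simp [hd]
  | succ n ih =>
    have hq : -(1 - 1 / p) ≠ 0 := by
      have : 1 < 1 / p := by rw [lt_div_iff₀ hp0]; linarith
      linarith
    refine (mul_eq_zero.1 ?_).resolve_left hq
    rw [← tsum_mul_left]
    set h : ι → (ι → ℕ) → ℝ := fun i => meixnerSum p n fun k y => G (k + 1) (Fin.cons i y) with hh
    have hgr : ∀ i, Grow (h i) := fun i => grow_meixnerSum _ _ _
    have e1 : ∀ N, -(1 - 1 / p) * (w N * (meixnerSum p (n + 1) G N * g N)) =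
        ∑ i, (1 / p * (w N * ((N i : ℝ) * h i (N - Pi.single i 1) * g N)) -
          w N * ((a i + N i) * h i N * g N)) := fun N => by
      have := meixnerSum_succ hp0 hp1 hG N
      rw [mul_left_comm, ← mul_assoc _ _ (g N), this, Finset.sum_mul, Finset.mul_sum]
      exact Finset.sum_congr rfl fun i _ => by ring
    have s1 : ∀ i, Summable fun N => w N * ((N i : ℝ) * h i (N - Pi.single i 1) * g N) := fun i =>
      hw.summable (((Grow.coord i).mul ((hgr i).unshift i)).mul hg)
    have s2 : ∀ i, Summable fun N => w N * ((a i + N i) * h i N * g N) := fun i =>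
      hw.summable ((((Grow.const (a i)).add (Grow.coord i)).mul (hgr i)).mul hg)
    rw [tsum_congr e1, Summable.tsum_finsetSum fun i _ => ((s1 i).mul_left _).sub (s2 i)]
    refine Finset.sum_eq_zero fun i _ => ?_
    have hg' : Grow (addPoint i g) := by
      convert (hg.shift i).add ((Grow.const (-1)).mul hg) using 1
      funext N
      simp [addPoint, sub_eq_add_neg]
    -- The factor p from summation by parts cancels 1 / p. What remains is the pairing of h i with
    -- `addPoint i g` under the raised weight, which is the induction hypothesis.
    rw [((s1 i).mul_left _).tsum_sub (s2 i), tsum_mul_left, hw.tsum_erase i (h i) g,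
      ← mul_assoc, one_div_mul_cancel hp0.ne', one_mul, ← ih (hw.raise i) (hs.cons i)
      (hG.cons hs i) hg' (hd i), ← Summable.tsum_sub]
    · exact tsum_congr fun N => by simp only [addPoint, hh]; ring
    · exact (hw.raise i).summable ((hgr i).mul (hg.shift i))
    · simpa only [mul_assoc, mul_left_comm] using s2 i

/-! ### Counting measures as sums of Dirac measures -/

/-- `μ` is a countable sum of Dirac measures. -/
def IsDiracSum (μ : Measure ℝ) : Prop :=
  ∃ (ι : Type) (_ : Countable ι) (x : ι → ℝ), μ = Measure.sum fun i => Measure.dirac (x i)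

theorem IsDiracSum.sum {I : Type} [Countable I] {ν : I → Measure ℝ} (h : ∀ i, IsDiracSum (ν i)) :
    IsDiracSum (Measure.sum ν) := by
  choose ι hι x hx using h
  refine ⟨Σ i, ι i, inferInstance, fun s => x s.1 s.2, ?_⟩
  ext B hB
  rw [Measure.sum_apply _ hB, Measure.sum_apply _ hB, ENNReal.tsum_sigma']
  refine tsum_congr fun i => ?_
  rw [hx i, Measure.sum_apply _ hB]

theorem IsDiracSum.add {μ ν : Measure ℝ} (hμ : IsDiracSum μ) (hν : IsDiracSum ν) :
    IsDiracSum (μ + ν) := by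
  have := IsDiracSum.sum (ν := fun b : Bool => cond b μ ν) (by rintro ⟨⟩ <;> assumption)
  rwa [Measure.sum_bool] at this

theorem isDiracSum_nsmul_dirac (k : ℕ) (x : ℝ) : IsDiracSum ((k : ℝ≥0∞) • Measure.dirac x) := by
  refine ⟨Fin k, inferInstance, fun _ => x, ?_⟩
  ext B hB
  simp

/-- On a set B of least positive mass k, every measurable subset has mass 0 or k, so ν restricted to
B and divided by k is a zero-one measure on ℝ, hence a Dirac measure. Splitting off B strictly
lowers the total mass. -/
theorem isDiracSum_of_forall_nat (m : ℕ) (ν : Measure ℝ) (hm : ν Set.univ = m)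
    (hν : ∀ B : Set ℝ, MeasurableSet B → ∃ m : ℕ, ν B = m) : IsDiracSum ν := by
  classical
  induction m using Nat.strong_induction_on generalizing ν with
  | _ m ih =>
  rcases Nat.eq_zero_or_pos m with rfl | hpos
  · refine ⟨Empty, inferInstance, Empty.elim, ?_⟩
    rw [Measure.sum_of_isEmpty, ← Measure.measure_univ_eq_zero, hm, Nat.cast_zero]
  have hex : ∃ k : ℕ, 0 < k ∧ ∃ B, MeasurableSet B ∧ ν B = k := ⟨m, hpos, _, .univ, hm⟩
  obtain ⟨hk, B, hB, hBk⟩ := Nat.find_spec hex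
  have hmin := fun j => Nat.find_min hex (m := j)
  generalize Nat.find hex = k at hk hBk hmin
  have hk0 : (k : ℝ≥0∞) ≠ 0 := by exact_mod_cast hk.ne'
  have : IsZeroOneMeasure ((k : ℝ≥0∞)⁻¹ • ν.restrict B) := ⟨fun s hs => by
    obtain ⟨j, hj⟩ := hν (s ∩ B) (hs.inter hB)
    simp only [Measure.smul_apply, smul_eq_mul, Measure.restrict_apply hs, hj]
    rcases Nat.eq_zero_or_pos j with rfl | hjp
    · simp
    · have h1 : k ≤ j := by
        by_contra! h
        exact hmin j h ⟨hjp, _, hs.inter hB, hj⟩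
      have h2 : (j : ℝ≥0∞) ≤ k := by
        rw [← hj, ← hBk]
        exact measure_mono Set.inter_subset_right
      have h3 : j = k := le_antisymm (by exact_mod_cast h2) h1
      right
      rw [h3, ENNReal.inv_mul_cancel hk0 (ENNReal.natCast_ne_top k)]⟩
  have : NeZero ((k : ℝ≥0∞)⁻¹ • ν.restrict B) := ⟨fun h => by
    have := congrArg (fun μ => μ Set.univ) h
    simp [hBk, hk0] at this⟩
  obtain ⟨x, hx⟩ := IsZeroOneMeasure.exists_eq_dirac (μ := (k : ℝ≥0∞)⁻¹ • ν.restrict B)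
  have hx' : ν.restrict B = (k : ℝ≥0∞) • Measure.dirac x := by
    rw [← hx, smul_smul, ENNReal.mul_inv_cancel hk0 (ENNReal.natCast_ne_top k), one_smul]
  rw [← Measure.restrict_add_restrict_compl hB (μ := ν), hx']
  refine (isDiracSum_nsmul_dirac k x).add ?_
  obtain ⟨l, hl⟩ := hν Bᶜ hB.compl
  refine ih l ?_ _ (by simpa using hl) fun C hC => ?_
  · have := measure_add_measure_compl hB (μ := ν)
    rw [hBk, hl, hm] at this
    have : k + l = m := by exact_mod_cast this
    omega
  · rw [Measure.restrict_apply hC]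
    exact hν _ (hC.inter hB.compl)

theorem IsCounting.isDiracSum {μ : Measure ℝ} (hμ : IsCounting μ) : IsDiracSum μ := by
  obtain ⟨ν, hν, rfl⟩ := hμ
  refine IsDiracSum.sum fun i => ?_
  obtain ⟨m, hm⟩ := hν i Set.univ .univ
  exact isDiracSum_of_forall_nat m _ hm (hν i)

/-! ### Listing the points of a configuration in a set of finite measure -/

/-- The boxes `Bᵏ`. -/
def box (k : ℕ) (B : Set ℝ) : Set (Fin k → ℝ) := Set.univ.pi fun _ => B

theorem mem_box {k : ℕ} {B : Set ℝ} {x : Fin k → ℝ} : x ∈ box k B ↔ ∀ i, x i ∈ B := by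
  simp [box]

theorem measurableSet_box {k : ℕ} {B : Set ℝ} (hB : MeasurableSet B) : MeasurableSet (box k B) :=
  MeasurableSet.univ_pi fun _ => hB

/-- The points of `μ` in `B` are listed by `x`. -/
structure Lists (μ : Config) (B : Set ℝ) {M : ℕ} (x : Fin M → ℝ) : Prop where
  mem : ∀ t, x t ∈ B
  restrict_eq : μ.1.restrict B = ∑ t, Measure.dirac (x t)
  factorial_restrict : ∀ k, (factorialMeasure μ.1 k).restrict (box k B) =
    ∑ e : Fin k ↪ Fin M, Measure.dirac fun i => x (e i)

/-- In a global enumeration by Dirac measures, finite mass leaves only finitely many indices with a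
point in B. A tuple lies in the box exactly when all its indices are among these, so the same list
serves every factorial measure. -/
theorem exists_lists (μ : Config) {B : Set ℝ} (hB : MeasurableSet B) (h : μ.1 B ≠ ∞) :
    ∃ (M : ℕ) (x : Fin M → ℝ), Lists μ B x := by
  classical
  obtain ⟨ι, hι, x, hx⟩ := μ.2.isDiracSum
  have hfin : Finite {i // x i ∈ B} := by
    rw [hx, Measure.sum_apply _ hB] at h
    refine ((ENNReal.finite_const_le_of_tsum_ne_top h one_ne_zero).subset fun i hi => ?_).to_subtype
    have hi : x i ∈ B := hi
    simp [Measure.dirac_apply' _ hB, hi]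
  have := Fintype.ofFinite {i // x i ∈ B}
  have E := (Fintype.equivFin {i // x i ∈ B}).symm
  refine ⟨_, fun t => x (E t).1, fun t => (E t).2, ?_, fun k => ?_⟩
  · ext s hs
    rw [hx, Measure.restrict_apply hs, Measure.sum_apply _ (hs.inter hB), Measure.finsetSum_apply,
      ← tsum_fintype (L := .unconditional _)]
    have hinj : Function.Injective fun t => (E t).1 := Subtype.val_injective.comp E.injective
    rw [← hinj.tsum_eq]
    · refine tsum_congr fun t => ?_
      rw [Measure.dirac_apply' _ (hs.inter hB), Measure.dirac_apply' _ hs]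
      simp [Set.indicator, (E t).2]
    · intro i hi
      have h1 : x i ∈ B := by
        by_contra h1
        exact hi (by simp [Measure.dirac_apply' _ (hs.inter hB), h1])
      exact ⟨E.symm ⟨i, h1⟩, by simp⟩
  · have hb := measurableSet_box (k := k) hB
    ext s hs
    rw [hx, factorialMeasure_sum_dirac, Measure.restrict_apply hs,
      Measure.sum_apply _ (hs.inter hb), Measure.finsetSum_apply,
      ← tsum_fintype (L := .unconditional _)]
    have hinj : Function.Injective fun e : Fin k ↪ Fin (Fintype.card {i // x i ∈ B}) =>
        e.trans (E.toEmbedding.trans (Function.Embedding.subtype _)) := by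
      intro e e' h
      ext i : 1
      exact E.injective (Subtype.val_injective (DFunLike.congr_fun h i))
    rw [← hinj.tsum_eq]
    · refine tsum_congr fun e => ?_
      rw [Measure.dirac_apply' _ (hs.inter hb), Measure.dirac_apply' _ hs]
      have : (fun i => x (E (e i)).1) ∈ box k B := mem_box.2 fun i => (E (e i)).2
      simp [Set.indicator, this]
    · intro e he
      have h1 : (fun i => x (e i)) ∈ box k B := by
        by_contra h1
        exact he (by simp [Measure.dirac_apply' _ (hs.inter hb), h1])
      rw [mem_box] at h1
      refine ⟨⟨fun i => E.symm ⟨e i, h1 i⟩, fun i j hij => ?_⟩, ?_⟩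
      · exact e.injective (congrArg Subtype.val (E.symm.injective hij))
      · ext i
        exact congrArg Subtype.val (E.apply_symm_apply ⟨e i, h1 i⟩)

namespace Lists
variable {μ : Config} {B : Set ℝ} {M : ℕ} {x : Fin M → ℝ}

theorem measure_eq_card (h : Lists μ B x) {A : Set ℝ} (hA : MeasurableSet A) (hAB : A ⊆ B) :
    μ.1 A = Nat.card {t // x t ∈ A} := by
  classical
  have h1 : μ.1 A = (μ.1.restrict B) A := by
    rw [Measure.restrict_apply hA, Set.inter_eq_self_of_subset_left hAB]
  rw [h1, h.restrict_eq, Measure.finsetSum_apply]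
  simp only [Measure.dirac_apply' _ hA, Set.indicator, Pi.one_apply, Finset.sum_boole]
  rw [Nat.card_eq_fintype_card, Fintype.card_subtype]

theorem measure_eq (h : Lists μ B x) (hB : MeasurableSet B) : μ.1 B = M := by
  rw [h.measure_eq_card hB le_rfl, Nat.card_congr (Equiv.subtypeUnivEquiv h.mem)]
  simp

theorem pi_restrict (h : Lists μ B x) [SigmaFinite μ.1] (k : ℕ) :
    (Measure.pi fun _ : Fin k => μ.1).restrict (box k B) =
      ∑ s : Fin k → Fin M, Measure.dirac fun i => x (s i) := by
  classical
  rw [box, Measure.restrict_pi_pi]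
  refine Measure.pi_eq fun A hA => ?_
  have h1 : ∀ i, μ.1.restrict B (A i) = ∑ t, Measure.dirac (x t) (A i) := fun i => by
    rw [h.restrict_eq, Measure.finsetSum_apply]
  simp only [h1, Measure.finsetSum_apply]
  rw [Finset.prod_univ_sum, Fintype.piFinset_univ]
  refine Finset.sum_congr rfl fun s _ => ?_
  rw [Measure.dirac_apply' _ (MeasurableSet.univ_pi hA)]
  simp only [Measure.dirac_apply' _ (hA _), Set.indicator, Set.mem_univ_pi, Pi.one_apply]
  split_ifs with hs
  · simp [hs]
  · push Not at hs
    obtain ⟨i, hi⟩ := hs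
    exact (Finset.prod_eq_zero (Finset.mem_univ i) (by simp [hi])).symm

theorem integral_eq_of_support {k : ℕ} {ν : Measure (Fin k → ℝ)} {f : (Fin k → ℝ) → ℝ}
    (hf : ∀ y, f y ≠ 0 → y ∈ box k B) : ∫ y, f y ∂ν = ∫ y, f y ∂ν.restrict (box k B) := by
  refine (setIntegral_eq_integral_of_forall_compl_eq_zero fun y hy => ?_).symm
  by_contra h
  exact hy (hf y h)

theorem integral_factorialMeasure (h : Lists μ B x) {k : ℕ} {f : (Fin k → ℝ) → ℝ}
    (hf : ∀ y, f y ≠ 0 → y ∈ box k B) :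
    ∫ y, f y ∂factorialMeasure μ.1 k = injSum k f x := by
  rw [integral_eq_of_support hf, h.factorial_restrict, integral_finsetSum_measure]
  · simp [integral_dirac, injSum]
  · exact fun e _ => integrable_dirac (by simp)

theorem monomial_eq (h : Lists μ B x) [SigmaFinite μ.1] {k : ℕ} {f : (Fin k → ℝ) → ℝ}
    (hf : ∀ y, f y ≠ 0 → y ∈ box k B) :
    monomial f μ = powSum k f x := by
  rw [monomial, integral_eq_of_support hf, h.pi_restrict, integral_finsetSum_measure]
  · simp [integral_dirac, powSum]
  · exact fun e _ => integrable_dirac (by simp)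

end Lists

/-! ### Integrating out variables one by one -/

theorem cons_comp_perm {X : Type*} {k : ℕ} (x : X) (y : Fin k → X) (σ : Equiv.Perm (Fin k)) :
    (Fin.cons x fun i => y (σ i) : Fin (k + 1) → X) =
      fun i => (Fin.cons x y : Fin (k + 1) → X) (Equiv.Perm.decomposeFin.symm (0, σ) i) := by
  funext i
  refine Fin.cases ?_ (fun j => ?_) i <;> simp [Equiv.Perm.decomposeFin_symm_apply_succ]

/-- Integrating out the first variable of `F` with respect to the sum of `I` and the Dirac measures
at the other variables. -/
def lower {X : Type*} (I : (X → ℝ) → ℝ) {k : ℕ} (F : (Fin (k + 1) → X) → ℝ) (y : Fin k → X) : ℝ :=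
  I (fun z => F (Fin.cons z y)) + ∑ j, F (Fin.cons (y j) y)

/-- The functions of `k ≤ n` variables which arise from `F` by integrating out variables. -/
def family {X : Type*} (I : (X → ℝ) → ℝ) :
    (n : ℕ) → ((Fin n → X) → ℝ) → (k : ℕ) → (Fin k → X) → ℝ
  -- Above level n the family is 0 by default; only the levels k ≤ n carry the lowering relation.
  | 0, F => Function.update (fun _ _ => 0) 0 F
  | n + 1, F => Function.update (family I n (lower I F)) (n + 1) F

theorem family_self {X : Type*} (I : (X → ℝ) → ℝ) (n : ℕ) (F : (Fin n → X) → ℝ) :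
    family I n F n = F := by
  cases n <;> simp [family]

theorem family_of_lt {X : Type*} (I : (X → ℝ) → ℝ) (n : ℕ) (F : (Fin n → X) → ℝ) {k : ℕ}
    (hk : k < n) : family I n F k = lower I (family I n F (k + 1)) := by
  induction n with
  | zero => omega
  | succ n ih =>
    have h1 : family I (n + 1) F k = family I n (lower I F) k := by
      simp [family, Function.update_of_ne hk.ne]
    rw [h1]
    rcases Nat.lt_succ_iff_lt_or_eq.1 hk with h | rfl
    · rw [ih _ h]
      congr 1
      have : k + 1 ≠ n + 1 := by omega
      simp [family, Function.update_of_ne this]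
    · rw [family_self, family_self]

theorem descending_induction {n : ℕ} {Q : ℕ → Prop} (hn : Q n) (h : ∀ k < n, Q (k + 1) → Q k)
    {k : ℕ} (hk : k ≤ n) : Q k :=
  Nat.decreasingInduction' (fun k hk _ => h k hk) hk hn

theorem lower_symm {X : Type*} (I : (X → ℝ) → ℝ) {k : ℕ} {F : (Fin (k + 1) → X) → ℝ}
    (hF : ∀ (σ : Equiv.Perm (Fin (k + 1))) y, F (fun i => y (σ i)) = F y)
    (σ : Equiv.Perm (Fin k)) (y : Fin k → X) : lower I F (fun i => y (σ i)) = lower I F y := by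
  simp only [lower, cons_comp_perm, hF]
  rw [Equiv.sum_comp σ fun j => F (Fin.cons (y j) y)]

theorem symmFamily_family {X : Type*} (I : (X → ℝ) → ℝ) {n : ℕ} {F : (Fin n → X) → ℝ}
    (hF : ∀ (σ : Equiv.Perm (Fin n)) y, F (fun i => y (σ i)) = F y) :
    SymmFamily n (family I n F) := by
  intro k hk
  refine descending_induction
    (Q := fun k => ∀ (σ : Equiv.Perm (Fin k)) (y : Fin k → X),
      (family I n F k fun i => y (σ i)) = family I n F k y) ?_ (fun k hk ih => ?_) hk
  · rwa [family_self]
  · rw [family_of_lt I n F hk]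
    exact lower_symm I ih

theorem loweringFamily_family {ι : Type*} [Fintype ι] (a : ι → ℝ) {n : ℕ} (F : (Fin n → ι) → ℝ) :
    LoweringFamily a n (family (fun u => ∑ i, a i * u i) n F) := fun k hk y => by
  rw [family_of_lt _ n F hk]
  rfl

/-- `symmetrization` for an arbitrary space. -/
def symm {X : Type*} {n : ℕ} (F : (Fin n → X) → ℝ) (x : Fin n → X) : ℝ :=
  (n ! : ℝ)⁻¹ * ∑ s : Equiv.Perm (Fin n), F fun i => x (s i)

theorem symm_comp_perm {X : Type*} {n : ℕ} (F : (Fin n → X) → ℝ) (σ : Equiv.Perm (Fin n))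
    (y : Fin n → X) : symm F (fun i => y (σ i)) = symm F y := by
  simp only [symm]
  rw [← Equiv.sum_comp (Equiv.mulLeft σ) fun s : Equiv.Perm (Fin n) => F fun i => y (s i)]
  rfl

/-! ### Bounded measurable functions on boxes -/

/-- Measurable functions which are bounded by `C` and vanish outside of the box `Bⁿ`. -/
structure TestOn (B : Set ℝ) (C : ℝ) {n : ℕ} (f : (Fin n → ℝ) → ℝ) : Prop where
  measurable : Measurable f
  bound : ∀ x, |f x| ≤ C
  support : ∀ x, f x ≠ 0 → x ∈ box n B

namespace TestOn
variable {B : Set ℝ} {C : ℝ} {n : ℕ} {f g : (Fin n → ℝ) → ℝ}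

theorem nonneg (hf : TestOn B C f) : 0 ≤ C := (abs_nonneg _).trans (hf.bound fun _ => 0)

theorem mono (hf : TestOn B C f) {B' : Set ℝ} {C' : ℝ} (hB : B ⊆ B') (hC : C ≤ C') :
    TestOn B' C' f :=
  ⟨hf.measurable, fun x => (hf.bound x).trans hC,
    fun x hx => mem_box.2 fun i => hB (mem_box.1 (hf.support x hx) i)⟩

theorem eq_zero (hf : TestOn B C f) {x : Fin n → ℝ} (hx : x ∉ box n B) : f x = 0 := by
  by_contra h
  exact hx (hf.support x h)

theorem add (hf : TestOn B C f) {D : ℝ} (hg : TestOn B D g) : TestOn B (C + D) fun x => f x + g x :=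
  ⟨hf.measurable.add hg.measurable,
    fun x => (abs_add_le _ _).trans (add_le_add (hf.bound x) (hg.bound x)), fun x hx => by
      by_contra h
      exact hx (by simp [hf.eq_zero h, hg.eq_zero h])⟩

theorem const_mul (hf : TestOn B C f) (c : ℝ) : TestOn B (|c| * C) fun x => c * f x :=
  ⟨hf.measurable.const_mul c, fun x => by
    rw [abs_mul]
    exact mul_le_mul_of_nonneg_left (hf.bound x) (abs_nonneg c), fun x hx =>
      hf.support x (right_ne_zero_of_mul hx)⟩

theorem comp_surjective (hf : TestOn B C f) {j : ℕ} {π : Fin n → Fin j}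
    (hπ : Function.Surjective π) : TestOn B C fun y : Fin j → ℝ => f fun i => y (π i) :=
  ⟨hf.measurable.comp (measurable_pi_lambda _ fun i => measurable_pi_apply _), fun _ => hf.bound _,
    fun y hy => mem_box.2 fun l => by
      obtain ⟨i, rfl⟩ := hπ l
      exact mem_box.1 (hf.support _ hy) i⟩

theorem symm (hf : TestOn B C f) : TestOn B C (symm f) := by
  have hm : ∀ s : Equiv.Perm (Fin n), Measurable fun x : Fin n → ℝ => f fun i => x (s i) :=
    fun s => (hf.comp_surjective s.surjective).measurable
  refine ⟨(Finset.measurable_sum _ fun s _ => hm s).const_mul _, fun x => ?_, fun x hx => ?_⟩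
  · rw [PascalMeixner.symm, abs_mul, abs_of_nonneg (by positivity)]
    have h1 : |∑ s : Equiv.Perm (Fin n), f fun i => x (s i)| ≤ (n ! : ℝ) * C := by
      refine (Finset.abs_sum_le_sum_abs _ _).trans ((Finset.sum_le_card_nsmul _ _ C
        fun s _ => hf.bound _).trans_eq ?_)
      rw [Finset.card_univ, Fintype.card_perm, Fintype.card_fin, nsmul_eq_mul]
    calc (n ! : ℝ)⁻¹ * |∑ s : Equiv.Perm (Fin n), f fun i => x (s i)|
        ≤ (n ! : ℝ)⁻¹ * ((n ! : ℝ) * C) := by gcongr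
      _ = C := by
        rw [← mul_assoc, inv_mul_cancel₀ (by positivity), one_mul]
  · by_contra h
    refine hx ?_
    rw [PascalMeixner.symm, Finset.sum_eq_zero fun s _ => ?_, mul_zero]
    exact (hf.comp_surjective s.surjective).eq_zero h

theorem measurable_cons (k : ℕ) :
    Measurable fun q : (Fin k → ℝ) × ℝ => (Fin.cons q.2 q.1 : Fin (k + 1) → ℝ) := by
  refine measurable_pi_lambda _ fun i => ?_
  refine Fin.cases ?_ (fun j => ?_) i
  · simpa using measurable_snd
  · simp only [Fin.cons_succ]
    fun_prop

theorem cons_mem_box {k : ℕ} {z : ℝ} {y : Fin k → ℝ} :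
    (Fin.cons z y : Fin (k + 1) → ℝ) ∈ box (k + 1) B ↔ z ∈ B ∧ y ∈ box k B := by
  simp [mem_box, Fin.forall_fin_succ]

theorem abs_integral_le {X : Type*} [MeasurableSpace X] {α : Measure X} {A : Set X}
    (hA : α A ≠ ∞) {u : X → ℝ} {C : ℝ} (hu : ∀ z, |u z| ≤ C) (hs : ∀ z, u z ≠ 0 → z ∈ A) :
    |∫ z, u z ∂α| ≤ C * (α A).toReal := by
  rw [← setIntegral_eq_integral_of_forall_compl_eq_zero (s := A) fun z hz => by
    by_contra h
    exact hz (hs z h)]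
  exact norm_setIntegral_le_of_norm_le_const (f := u) hA.lt_top fun z _ => hu z

theorem integrable_of_support {X : Type*} [MeasurableSpace X] {α : Measure X} {A : Set X}
    (hA : α A ≠ ∞) {u : X → ℝ} {C : ℝ} (hm : Measurable u) (hu : ∀ z, |u z| ≤ C)
    (hs : ∀ z, u z ≠ 0 → z ∈ A) : Integrable u α := by
  rw [← integrableOn_iff_integrable_of_support_subset (s := A) fun z hz => hs z hz]
  exact Measure.integrableOn_of_bounded hA hm.aestronglyMeasurable (M := C)
    (Filter.Eventually.of_forall hu)

theorem lower {k : ℕ} {F : (Fin (k + 1) → ℝ) → ℝ} (hF : TestOn B C F) {α : Measure ℝ} [SFinite α]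
    (hα : α B ≠ ∞) :
    TestOn B (C * (α B).toReal + k * C) (lower (fun u => ∫ z, u z ∂α) F) := by
  have hs : ∀ y z, F (Fin.cons z y) ≠ 0 → z ∈ B := fun y z h => (cons_mem_box.1 (hF.support _ h)).1
  refine ⟨?_, fun y => ?_, fun y hy => ?_⟩
  · refine Measurable.add ?_ (Finset.measurable_sum _ fun j _ => ?_)
    · exact ((hF.measurable.comp (measurable_cons k)).stronglyMeasurable.integral_prod_right'
        (ν := α)).measurable
    · exact hF.measurable.comp ((measurable_cons k).comp
        (measurable_id.prodMk (measurable_pi_apply j)))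
  · refine (abs_add_le _ _).trans (add_le_add
      (abs_integral_le hα (fun z => hF.bound _) (hs y)) ?_)
    refine (Finset.abs_sum_le_sum_abs _ _).trans ((Finset.sum_le_card_nsmul _ _ C
        fun s _ => hF.bound _).trans_eq ?_)
    simp
  · by_contra h
    have h0 : ∀ z, F (Fin.cons z y) = 0 := fun z => by
      by_contra h1
      exact h (cons_mem_box.1 (hF.support _ h1)).2
    exact hy (by simp [PascalMeixner.lower, h0])

end TestOn

/-- The bound is chosen before f: this uniformity supplies the dominating functions in the later
limit arguments. -/
theorem exists_testOn_family {B : Set ℝ} {α : Measure ℝ} [SFinite α] (hα : α B ≠ ∞) (n : ℕ) (C : ℝ)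
    {k : ℕ} (hk : k ≤ n) : ∃ C', ∀ f : (Fin n → ℝ) → ℝ, TestOn B C f →
      TestOn B C' (family (fun u => ∫ z, u z ∂α) n f k) := by
  refine descending_induction (Q := fun k => ∃ C', ∀ f : (Fin n → ℝ) → ℝ, TestOn B C f →
      TestOn B C' (family (fun u => ∫ z, u z ∂α) n f k)) ?_ (fun k hk ih => ?_) hk
  · exact ⟨C, fun f hf => by rwa [family_self]⟩
  · obtain ⟨C', h⟩ := ih
    refine ⟨C' * (α B).toReal + k * C', fun f hf => ?_⟩
    rw [family_of_lt _ n f hk]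
    exact (h f hf).lower hα

/-! ### The kernels -/

/-- The step after m new points gives B mass at most α B + k + m, whatever the points are.
Finiteness provides the integrability required to split the composed kernels. -/
theorem kappa_box_ne_top {α : Measure ℝ} [SFinite α] {B : Set ℝ} (hB : MeasurableSet B)
    (hα : α B ≠ ∞) (k m : ℕ) (x : Fin k → ℝ) : kappa α k m x (box m B) ≠ ∞ := by
  induction m with
  | zero => simp [kappa, box]
  | succ m ih =>
    have hb := measurableSet_box (k := m + 1) hB
    rw [← lintegral_indicator_one hb, lintegral_kappa_succ _ _ _ _ (measurable_one.indicator hb)]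
    refine ne_top_of_le_ne_top (b := ∫⁻ y, (box m B).indicator 1 y * (α B + k + m)
      ∂kappa α k m x) ?_ (lintegral_mono fun y => ?_)
    · rw [lintegral_mul_const _ (measurable_one.indicator (measurableSet_box hB)),
        lintegral_indicator_one (measurableSet_box hB)]
      refine ENNReal.mul_ne_top ih ?_
      simp [hα]
    · have h1 : ∀ z, (box (m + 1) B).indicator (1 : (Fin (m + 1) → ℝ) → ℝ≥0∞) (Fin.snoc y z) =
          (box m B).indicator 1 y * B.indicator 1 z := fun z => by
        have : (Fin.snoc y z : Fin (m + 1) → ℝ) ∈ box (m + 1) B ↔ y ∈ box m B ∧ z ∈ B := by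
          simp [mem_box, Fin.forall_fin_succ']
        by_cases hy : y ∈ box m B <;> by_cases hz : z ∈ B <;> simp [Set.indicator, this, hy, hz]
      simp only [h1]
      rw [lintegral_const_mul _ (measurable_one.indicator hB), lintegral_indicator_one hB]
      refine mul_le_mul_right ?_ _
      simp only [Measure.add_apply, Measure.finsetSum_apply]
      refine add_le_add (add_le_add le_rfl ?_) ?_
      · exact (Finset.sum_le_card_nsmul _ _ 1 fun i _ => prob_le_one).trans_eq (by simp)
      · exact (Finset.sum_le_card_nsmul _ _ 1 fun i _ => prob_le_one).trans_eq (by simp)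

theorem integral_add_sum_dirac {α : Measure ℝ} {u : ℝ → ℝ} (hu : Integrable u α) {k : ℕ}
    (x : Fin k → ℝ) :
    ∫ z, u z ∂(α + ∑ i, Measure.dirac (x i)) = ∫ z, u z ∂α + ∑ i, u (x i) := by
  have h : ∀ i ∈ (Finset.univ : Finset (Fin k)), Integrable u (Measure.dirac (x i)) :=
    fun i _ => integrable_dirac (by simp)
  rw [integral_add_measure hu (integrable_finsetSum_measure.2 h), integral_finsetSum_measure h]
  simp [integral_dirac]

/-- The kernel integrates out the last variable first, whereas `lower` removes the first one; the
symmetry of the family makes the two agree. One factor of the kernel is peeled off per induction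
step. -/
theorem integral_kappa_family {α : Measure ℝ} [SFinite α] {B : Set ℝ} (hB : MeasurableSet B)
    (hα : α B ≠ ∞) {n : ℕ} {f : (Fin n → ℝ) → ℝ} {C : ℝ} (hf : TestOn B C f)
    (hs : ∀ (σ : Equiv.Perm (Fin n)) y, f (fun i => y (σ i)) = f y) (k m : ℕ) (h : k + m ≤ n)
    (x : Fin k → ℝ) :
    ∫ y, family (fun u => ∫ z, u z ∂α) n f (k + m) (Fin.append x y) ∂kappa α k m x =
      family (fun u => ∫ z, u z ∂α) n f k x := by
  set G := family (fun u => ∫ z, u z ∂α) n f with hG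
  induction m with
  | zero =>
    rw [kappa, Kernel.const_apply, integral_dirac, Fin.append_elim0]
    rfl
  | succ m ih =>
    obtain ⟨D, hD⟩ := exists_testOn_family hα n C h
    have hD := hD f hf
    rw [← hG] at hD
    have hsnoc : ∀ y : Fin (k + m) → ℝ, ∀ z, G (k + m + 1) (Fin.snoc y z) =
        G (k + m + 1) (Fin.cons z y) := fun y z => by
      rw [Fin.snoc_eq_cons_rotate]
      exact symmFamily_family _ hs (k + m + 1) h _ _
    have hap : Measurable fun y : Fin (m + 1) → ℝ => G (k + (m + 1)) (Fin.append x y) :=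
      hD.measurable.comp ((measurable_append k (m + 1)).comp measurable_prodMk_left)
    have hint : Integrable (fun y : Fin (m + 1) → ℝ => G (k + (m + 1)) (Fin.append x y))
        (kappa α k (m + 1) x) := by
      refine TestOn.integrable_of_support (kappa_box_ne_top hB hα k (m + 1) x) hap
        (fun z => hD.bound _) fun y hy => mem_box.2 fun i => ?_
      have := mem_box.1 (hD.support _ hy) (Fin.natAdd k i)
      rwa [Fin.append_right] at this
    rw [kappa, Kernel.map_apply _ (measurable_snoc m)] at hint ⊢
    rw [integral_map (measurable_snoc m).aemeasurable hap.aestronglyMeasurable]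
    have hint' := (integrable_map_measure hap.aestronglyMeasurable
      (measurable_snoc m).aemeasurable).1 hint
    rw [integral_compProd (f := fun q : (Fin m → ℝ) × ℝ => G (k + (m + 1))
      (Fin.append x (Fin.snoc q.1 q.2 : Fin (m + 1) → ℝ))) hint', ← ih (by omega)]
    refine integral_congr_ae (Filter.Eventually.of_forall fun y => ?_)
    simp only [Kernel.comap_apply, kappaStep_apply, Fin.append_snoc]
    rw [hG, family_of_lt _ n f (by omega : k + m < n), ← hG, PascalMeixner.lower]
    simp only [← hsnoc]
    refine integral_add_sum_dirac ?_ _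
    have hms : Measurable fun z : ℝ => (Fin.snoc (Fin.append x y) z : Fin (k + m + 1) → ℝ) :=
      (measurable_snoc (k + m)).comp (measurable_prodMk_left (x := Fin.append x y))
    refine TestOn.integrable_of_support hα (C := D) (hD.measurable.comp hms)
      (fun z => hD.bound _) fun z hz => ?_
    have := mem_box.1 (hD.support _ hz) (Fin.last _)
    rwa [Fin.snoc_last] at this

/-- Keeping r as a separate variable allows n to be replaced by k + r, which avoids casts between
index types. -/
theorem integral_join {α : Measure ℝ} [SFinite α] {B : Set ℝ} (hB : MeasurableSet B)
    (hα : α B ≠ ∞) {n : ℕ} {f : (Fin n → ℝ) → ℝ} {C : ℝ} (hf : TestOn B C f)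
    (hs : ∀ (σ : Equiv.Perm (Fin n)) y, f (fun i => y (σ i)) = f y) {k r : ℕ} (hk : k ≤ n)
    (hr : r = n - k) (x : Fin k → ℝ) :
    ∫ y : Fin r → ℝ, f (fun i => if h : (i : ℕ) < k then x ⟨i, h⟩ else y ⟨i - k, by omega⟩)
      ∂kappa α k r x = family (fun u => ∫ z, u z ∂α) n f k x := by
  obtain rfl : n = k + r := by omega
  rw [← integral_kappa_family hB hα hf hs k r le_rfl x]
  refine integral_congr_ae (Filter.Eventually.of_forall fun y => ?_)
  simp only [family_self]
  congr 1
  funext i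
  refine Fin.addCases (fun j => ?_) (fun j => ?_) i
  · simp
  · simp

theorem meixner_eq {α : Measure ℝ} [SFinite α] {B : Set ℝ} (hB : MeasurableSet B)
    (hα : α B ≠ ∞) {n : ℕ} {f : (Fin n → ℝ) → ℝ} {C : ℝ} (hf : TestOn B C f) (p : ℝ)
    {μ : Config} {M : ℕ} {x : Fin M → ℝ} (hx : Lists μ B x) :
    meixner p α f μ = ∑ k ∈ Finset.range (n + 1),
      (n.choose k : ℝ) * (1 - 1 / p) ^ ((k : ℤ) - (n : ℤ)) *
        injSum k (family (fun u => ∫ z, u z ∂α) n (symm f) k) x := by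
  refine Finset.sum_congr rfl fun k hk => congrArg _ ?_
  have hk : k ≤ n := Nat.lt_succ_iff.1 (Finset.mem_range.1 hk)
  obtain ⟨D, hD⟩ := exists_testOn_family hα n C hk
  rw [← hx.integral_factorialMeasure (hD _ hf.symm).support]
  refine integral_congr_ae (Filter.Eventually.of_forall fun y => ?_)
  exact integral_join hB hα hf.symm (symm_comp_perm f) hk rfl y

/-! ### The negative binomial distribution -/

/-- The weights of the negative binomial distribution. -/
def nbWeight (p a : ℝ) (k : ℕ) : ℝ :=
  (∏ i ∈ Finset.range k, (a + i)) * (p ^ k / k !) * (1 - p) ^ a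

theorem nbWeight_nonneg {p a : ℝ} (hp0 : 0 < p) (hp1 : p < 1) (ha : 0 ≤ a) (k : ℕ) :
    0 ≤ nbWeight p a k := by
  have h1 : 0 ≤ ∏ i ∈ Finset.range k, (a + (i : ℝ)) := Finset.prod_nonneg fun i _ => by positivity
  have h2 : 0 ≤ (1 - p) ^ a := Real.rpow_nonneg (by linarith) _
  unfold nbWeight
  positivity

theorem nbWeight_succ (p a : ℝ) (k : ℕ) :
    ((k : ℝ) + 1) * nbWeight p a (k + 1) = p * ((a + k) * nbWeight p a k) := by
  have h : ((k : ℝ) + 1) ≠ 0 := by positivity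
  have h' : (k ! : ℝ) ≠ 0 := by positivity
  rw [nbWeight, nbWeight, Finset.prod_range_succ, Nat.factorial_succ]
  push_cast
  field_simp
  ring

theorem nbWeight_zero_zero (p : ℝ) : nbWeight p 0 0 = 1 := by
  simp [nbWeight]

theorem nbWeight_zero_succ (p : ℝ) (k : ℕ) : nbWeight p 0 (k + 1) = 0 := by
  simp [nbWeight, Finset.prod_range_succ']

theorem ascPochhammer_eval_eq_prod_range (a : ℝ) (k : ℕ) :
    Polynomial.eval a (ascPochhammer ℝ k) = ∏ i ∈ Finset.range k, (a + (i : ℝ)) := by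
  induction k with
  | zero => simp
  | succ k ih => rw [ascPochhammer_succ_eval, ih, Finset.prod_range_succ]

/-- This is the binomial series of (1 - x) ^ (-a) at x = p, its coefficients being rising factorials
divided by k !. -/
theorem hasSum_nbWeight {p : ℝ} (hp0 : 0 < p) (hp1 : p < 1) (a : ℝ) :
    HasSum (nbWeight p a) 1 := by
  have h := (Real.one_div_one_sub_rpow_hasFPowerSeriesOnBall_zero a).hasSum (y := p) (by
    rw [Metric.mem_eball, edist_zero_right, Real.enorm_eq_ofReal hp0.le]
    exact_mod_cast ENNReal.ofReal_lt_one.2 hp1)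
  have hpos : 0 < (1 - p) ^ a := Real.rpow_pos_of_pos (by linarith) _
  have h' := h.mul_right ((1 - p) ^ a)
  rw [zero_add, one_div_mul_cancel hpos.ne'] at h'
  refine h'.congr_fun ?_
  intro k
  rw [FormalMultilinearSeries.ofScalars_apply_eq, nbWeight, smul_eq_mul]
  congr 1
  have h1 : Ring.choose (a + k - 1) k = Ring.multichoose a k := by
    rw [Ring.choose]
    congr 1
    ring
  have h2 := Ring.factorial_nsmul_multichoose_eq_ascPochhammer a k
  rw [nsmul_eq_mul, Polynomial.ascPochhammer_smeval_eq_eval] at h2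
  rw [h1, ← ascPochhammer_eval_eq_prod_range, ← h2]
  have h' : (k ! : ℝ) ≠ 0 := by positivity
  field_simp

/-- Ratio test: consecutive terms have ratio tending to p < 1. The case a = 0 is separate because
its terms vanish for k ≥ 1. -/
theorem summable_nbWeight_mul_pow {p a : ℝ} (hp0 : 0 < p) (hp1 : p < 1) (ha : 0 ≤ a) (d : ℕ) :
    Summable fun k : ℕ => nbWeight p a k * (1 + (k : ℝ)) ^ d := by
  rcases ha.eq_or_lt with rfl | ha
  · refine summable_of_ne_finset_zero (s := {0}) fun k hk => ?_
    obtain ⟨k, rfl⟩ := Nat.exists_eq_succ_of_ne_zero (by simpa using hk)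
    simp [nbWeight_zero_succ]
  have hpos : ∀ k, 0 < nbWeight p a k := fun k => by
    have h1 : 0 < ∏ i ∈ Finset.range k, (a + (i : ℝ)) := Finset.prod_pos fun i _ => by positivity
    have h2 : 0 < (1 - p) ^ a := Real.rpow_pos_of_pos (by linarith) _
    unfold nbWeight
    positivity
  have hpos' : ∀ k : ℕ, 0 < nbWeight p a k * (1 + (k : ℝ)) ^ d := fun k => by
    have := hpos k
    positivity
  refine summable_of_ratio_test_tendsto_lt_one hp1
    (Filter.Eventually.of_forall fun k => (hpos' k).ne') ?_
  have h1 : Filter.Tendsto (fun k : ℕ => ((k : ℝ) + 1)⁻¹) Filter.atTop (nhds 0) := by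
    simpa using tendsto_one_div_add_atTop_nhds_zero_nat (𝕜 := ℝ)
  have h2 : Filter.Tendsto (fun k : ℕ => p * (1 + (a - 1) * ((k : ℝ) + 1)⁻¹) *
      (1 + ((k : ℝ) + 1)⁻¹) ^ d) Filter.atTop (nhds (p * (1 + (a - 1) * 0) * (1 + 0) ^ d)) :=
    ((tendsto_const_nhds.add (h1.const_mul _)).const_mul _).mul
      ((tendsto_const_nhds.add h1).pow d)
  simp only [mul_zero, add_zero, one_pow, mul_one] at h2
  refine h2.congr fun k => ?_
  rw [Real.norm_of_nonneg (hpos' _).le, Real.norm_of_nonneg (hpos' _).le, eq_div_iff (hpos' k).ne']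
  have hk : ((k : ℝ) + 1) ≠ 0 := by positivity
  have h3 : nbWeight p a (k + 1) = p * (1 + (a - 1) * ((k : ℝ) + 1)⁻¹) * nbWeight p a k := by
    have := nbWeight_succ p a k
    field_simp
    linear_combination this
  have h4 : (1 + ((k + 1 : ℕ) : ℝ)) ^ d = (1 + ((k : ℝ) + 1)⁻¹) ^ d * (1 + (k : ℝ)) ^ d := by
    rw [← mul_pow]
    congr 1
    push_cast
    field_simp
    ring
  rw [h3, h4]
  ring

/-! ### Counts of a Pascal process -/

/-- The number of points in `A`. -/
def count (A : Set ℝ) (μ : Config) : ℕ := ⌊(μ.1 A).toReal⌋₊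

theorem count_eq {A : Set ℝ} {μ : Config} {k : ℕ} (h : μ.1 A = k) : count A μ = k := by
  simp [count, h]

theorem measurable_eval {A : Set ℝ} (hA : MeasurableSet A) :
    Measurable fun μ : Config => μ.1 A :=
  (Measure.measurable_coe hA).comp measurable_subtype_coe

theorem measurable_count {A : Set ℝ} (hA : MeasurableSet A) : Measurable (count A) :=
  (measurable_eval hA).ennreal_toReal.nat_floor

namespace IsPascalLaw
variable {α : Measure ℝ} {p : ℝ} {ρ : Measure Config}

/-- With parameter 0 the negative binomial weights degenerate to a point mass at 0, so null cells
need no separate treatment later. -/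
theorem measure_eval_eq (hρ : IsPascalLaw α p ρ) {A : Set ℝ} (hA : MeasurableSet A)
    (hα : α A ≠ ∞) (k : ℕ) :
    ρ {μ | μ.1 A = k} = ENNReal.ofReal (nbWeight p (α A).toReal k) := by
  have := hρ.isProbabilityMeasure
  rcases eq_or_ne (α A) 0 with h | h
  · have h0 := hρ.null A hA h
    rw [h, ENNReal.toReal_zero]
    cases k with
    | zero =>
      rw [nbWeight_zero_zero, ENNReal.ofReal_one]
      refine (mem_ae_iff_prob_eq_one (measurable_eval hA (measurableSet_singleton _))).1 ?_
      filter_upwards [h0] with μ hμ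
      simpa using hμ
    | succ k =>
      rw [nbWeight_zero_succ, ENNReal.ofReal_zero]
      refine measure_mono_null (fun μ hμ => ?_) (ae_iff.1 h0)
      have hμ : μ.1 A = (k + 1 : ℕ) := hμ
      simp [hμ]
  · exact hρ.negBinomial A hA (pos_iff_ne_zero.2 h) hα.lt_top k

/-- The weights already sum to 1, so the natural number values exhaust the probability and ∞ is
excluded almost surely. -/
theorem ae_eq_count (hρ : IsPascalLaw α p ρ) (hp0 : 0 < p) (hp1 : p < 1) {A : Set ℝ}
    (hA : MeasurableSet A) (hα : α A ≠ ∞) : ∀ᵐ μ ∂ρ, μ.1 A = count A μ := by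
  have := hρ.isProbabilityMeasure
  have hm : ∀ k : ℕ, MeasurableSet {μ : Config | μ.1 A = k} := fun k =>
    measurable_eval hA (measurableSet_singleton _)
  have h1 : ρ (⋃ k : ℕ, {μ : Config | μ.1 A = k}) = 1 := by
    rw [measure_iUnion (fun i j hij => Set.disjoint_left.2 fun μ hi hj => hij ?_) hm]
    · simp only [hρ.measure_eval_eq hA hα]
      rw [← ENNReal.ofReal_tsum_of_nonneg (nbWeight_nonneg hp0 hp1 ENNReal.toReal_nonneg)
        (hasSum_nbWeight hp0 hp1 _).summable, (hasSum_nbWeight hp0 hp1 _).tsum_eq,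
        ENNReal.ofReal_one]
    · have hi : μ.1 A = i := hi
      have hj : μ.1 A = j := hj
      exact_mod_cast hi.symm.trans hj
  have h2 := (mem_ae_iff_prob_eq_one (MeasurableSet.iUnion hm)).2 h1
  filter_upwards [h2] with μ hμ
  obtain ⟨k, hk⟩ := Set.mem_iUnion.1 hμ
  have hk : μ.1 A = k := hk
  rw [hk, count_eq hk]

theorem ae_isLocallyFiniteMeasure [IsLocallyFiniteMeasure α] (hρ : IsPascalLaw α p ρ) (hp0 : 0 < p)
    (hp1 : p < 1) : ∀ᵐ μ ∂ρ, IsLocallyFiniteMeasure μ.1 := by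
  have h : ∀ᵐ μ ∂ρ, ∀ n : ℕ, μ.1 (Set.Icc (-n : ℝ) n) = count (Set.Icc (-n : ℝ) n) μ :=
    ae_all_iff.2 fun n => hρ.ae_eq_count hp0 hp1 measurableSet_Icc isCompact_Icc.measure_ne_top
  filter_upwards [h] with μ hμ
  refine ⟨fun x => ?_⟩
  obtain ⟨n, hn⟩ := exists_nat_gt |x|
  refine ⟨Set.Icc (-n : ℝ) n, Icc_mem_nhds (neg_lt_of_abs_lt hn) (lt_of_abs_lt hn), ?_⟩
  rw [hμ n]
  exact ENNReal.natCast_lt_top _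

theorem integrable_count_pow (hρ : IsPascalLaw α p ρ) (hp0 : 0 < p) (hp1 : p < 1) {A : Set ℝ}
    (hA : MeasurableSet A) (hα : α A ≠ ∞) (d : ℕ) :
    Integrable (fun μ => (1 + (count A μ : ℝ)) ^ d) ρ := by
  have := hρ.isProbabilityMeasure
  have hc := measurable_count hA
  suffices h : Integrable (fun k : ℕ => (1 + (k : ℝ)) ^ d) (ρ.map (count A)) from
    (integrable_map_measure h.aestronglyMeasurable hc.aemeasurable).1 h
  have := Measure.isProbabilityMeasure_map (μ := ρ) hc.aemeasurable
  rw [← Measure.sum_smul_dirac (ρ.map (count A)),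
    integrable_sum_dirac_iff fun k => measure_ne_top _ _]
  refine (summable_nbWeight_mul_pow hp0 hp1 (ENNReal.toReal_nonneg (a := α A)) d).congr fun k => ?_
  rw [Measure.map_apply hc (measurableSet_singleton k)]
  have h1 : count A ⁻¹' {k} =ᵐ[ρ] {μ : Config | μ.1 A = k} := by
    filter_upwards [hρ.ae_eq_count hp0 hp1 hA hα] with μ hμ
    refine propext ⟨fun h => ?_, fun h => count_eq h⟩
    have h : count A μ = k := h
    exact hμ.trans (by rw [h])
  rw [measure_congr h1, hρ.measure_eval_eq hA hα,
    ENNReal.toReal_ofReal (nbWeight_nonneg hp0 hp1 ENNReal.toReal_nonneg k),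
    Real.norm_of_nonneg (by positivity)]

/-- The numbers of points in the cells `D i`. -/
theorem measure_counts_eq (hρ : IsPascalLaw α p ρ) (hp0 : 0 < p) (hp1 : p < 1) {ι : Type}
    [Fintype ι] {D : ι → Set ℝ} (hD : ∀ i, MeasurableSet (D i))
    (hd : Pairwise fun i j => Disjoint (D i) (D j)) (hα : ∀ i, α (D i) ≠ ∞) (N : ι → ℕ) :
    ρ.real {μ | (fun i => count (D i) μ) = N} = ∏ i, nbWeight p (α (D i)).toReal (N i) := by
  have := hρ.isProbabilityMeasure
  have e := (Fintype.equivFin ι).symm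
  have hi : iIndepFun (fun i (μ : Config) => μ.1 (D i)) ρ :=
    iIndepFun.of_precomp e.surjective (hρ.indep _ (fun j => D (e j)) (fun j => hD _)
      fun i j hij => hd (e.injective.ne hij))
  have h1 : {μ | (fun i => count (D i) μ) = N} =ᵐ[ρ] ⋂ i, {μ : Config | μ.1 (D i) = N i} := by
    filter_upwards [ae_all_iff.2 fun i => hρ.ae_eq_count hp0 hp1 (hD i) (hα i)] with μ hμ
    refine propext ⟨fun h => Set.mem_iInter.2 fun i => ?_, fun h => funext fun i => ?_⟩
    · have h : (fun i => count (D i) μ) = N := h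
      exact (hμ i).trans (by rw [← h])
    · exact count_eq (Set.mem_iInter.1 h i)
  have h2 : ρ (⋂ i, {μ : Config | μ.1 (D i) = N i}) = ∏ i, ρ {μ : Config | μ.1 (D i) = N i} :=
    hi.meas_iInter fun i => ⟨{(N i : ℝ≥0∞)}, measurableSet_singleton _, rfl⟩
  rw [Measure.real, measure_congr h1, h2, ENNReal.toReal_prod]
  refine Finset.prod_congr rfl fun i _ => ?_
  rw [hρ.measure_eval_eq (hD i) (hα i),
    ENNReal.toReal_ofReal (nbWeight_nonneg hp0 hp1 ENNReal.toReal_nonneg _)]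

theorem ae_sum_count (hρ : IsPascalLaw α p ρ) (hp0 : 0 < p) (hp1 : p < 1) {ι : Type}
    [Fintype ι] {D : ι → Set ℝ} (hD : ∀ i, MeasurableSet (D i))
    (hd : Pairwise fun i j => Disjoint (D i) (D j)) (hα : ∀ i, α (D i) ≠ ∞) :
    ∀ᵐ μ ∂ρ, ∑ i, count (D i) μ = count (⋃ i, D i) μ := by
  filter_upwards [ae_all_iff.2 fun i => hρ.ae_eq_count hp0 hp1 (hD i) (hα i)] with μ hμ
  refine (count_eq ?_).symm
  rw [measure_iUnion hd hD, tsum_fintype, Finset.sum_congr rfl fun i _ => hμ i]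
  push_cast
  rfl

theorem measurable_counts {ι : Type} {D : ι → Set ℝ} (hD : ∀ i, MeasurableSet (D i)) :
    Measurable fun (μ : Config) i => count (D i) μ :=
  measurable_pi_lambda _ fun i => measurable_count (hD i)

/-- By independence the joint weight is a product, and adding a point changes only one factor. The
total count is the count of the union of the cells, so the moments reduce to one negative binomial
variable. -/
theorem isPascalWeight (hρ : IsPascalLaw α p ρ) (hp0 : 0 < p) (hp1 : p < 1) {ι : Type}
    [Fintype ι] [DecidableEq ι] {D : ι → Set ℝ} (hD : ∀ i, MeasurableSet (D i))
    (hd : Pairwise fun i j => Disjoint (D i) (D j)) (hα : ∀ i, α (D i) ≠ ∞) :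
    IsPascalWeight p (fun i => (α (D i)).toReal)
      fun N => ρ.real {μ | (fun i => count (D i) μ) = N} where
  rec_add_single N i := by
    simp only [hρ.measure_counts_eq hp0 hp1 hD hd hα]
    rw [← Finset.mul_prod_erase _ _ (Finset.mem_univ i), ← Finset.mul_prod_erase _ _
      (Finset.mem_univ i), Finset.prod_congr rfl fun j hj => by
        rw [Pi.add_apply, Pi.single_eq_of_ne (Finset.ne_of_mem_erase hj), add_zero]]
    simp only [Pi.add_apply, Pi.single_eq_same]
    linear_combination (∏ j ∈ Finset.univ.erase i, nbWeight p (α (D j)).toReal (N j)) *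
      nbWeight_succ p (α (D i)).toReal (N i)
  summable_moment d := by
    have := hρ.isProbabilityMeasure
    have hc := measurable_counts hD
    have hU : α (⋃ i, D i) ≠ ∞ := by
      rw [measure_iUnion hd hD, tsum_fintype]
      exact ENNReal.sum_ne_top.2 fun i _ => hα i
    have h1 : Integrable (fun μ => (1 + ∑ i, (count (D i) μ : ℝ)) ^ d) ρ := by
      refine (hρ.integrable_count_pow hp0 hp1 (MeasurableSet.iUnion hD) hU d).congr ?_
      filter_upwards [hρ.ae_sum_count hp0 hp1 hD hd hα] with μ hμ
      rw [← hμ]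
      push_cast
      rfl
    have h2 : Integrable (fun N : ι → ℕ => (1 + ∑ i, (N i : ℝ)) ^ d)
        (ρ.map fun μ i => count (D i) μ) :=
      (integrable_map_measure (measurable_of_countable _).aestronglyMeasurable hc.aemeasurable).2 h1
    have := Measure.isProbabilityMeasure_map (μ := ρ) hc.aemeasurable
    rw [← Measure.sum_smul_dirac (ρ.map _),
      integrable_sum_dirac_iff fun k => measure_ne_top _ _] at h2
    refine h2.congr fun N => ?_
    rw [Measure.map_apply hc (measurableSet_singleton N), Real.norm_of_nonneg (by positivity),
      abs_of_nonneg measureReal_nonneg]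
    rfl

theorem integral_counts (hρ : IsPascalLaw α p ρ) {ι : Type} [Finite ι] {D : ι → Set ℝ}
    (hD : ∀ i, MeasurableSet (D i)) {H : (ι → ℕ) → ℝ}
    (hH : Integrable (fun μ => H fun i => count (D i) μ) ρ) :
    ∫ μ, (H fun i => count (D i) μ) ∂ρ =
      ∑' N, ρ.real {μ | (fun i => count (D i) μ) = N} * H N := by
  have := hρ.isProbabilityMeasure
  have hc := measurable_counts hD
  have hm : AEStronglyMeasurable H (ρ.map fun μ i => count (D i) μ) :=
    (measurable_of_countable _).aestronglyMeasurable
  rw [← integral_map hc.aemeasurable hm,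
    integral_countable ((integrable_map_measure hm hc.aemeasurable).2 hH)]
  refine tsum_congr fun N => ?_
  rw [Measure.real, Measure.map_apply hc (measurableSet_singleton N), smul_eq_mul]
  rfl

end IsPascalLaw

/-! ### A monotone class theorem for bounded functions on boxes -/

theorem testOn_indicator {B : Set ℝ} {n : ℕ} {s : Set (Fin n → ℝ)} (hs : MeasurableSet s)
    (hsB : s ⊆ box n B) : TestOn B 1 (s.indicator fun _ => (1 : ℝ)) := by
  refine ⟨measurable_const.indicator hs, fun x => ?_, fun x hx => hsB ?_⟩
  · by_cases h : x ∈ s <;> simp [h]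
  · by_contra h
    exact hx (by simp [h])

/-- The π-λ theorem extends Q from rectangles to all measurable sets inside the box; simple
functions and bounded pointwise limits do the rest. Every hypothesis carries its `TestOn` bound, so
that integrability and a common bound are at hand when it is verified. -/
theorem TestOn.induction_on_boxes {B : Set ℝ} (hB : MeasurableSet B) {n : ℕ}
    {Q : ((Fin n → ℝ) → ℝ) → Prop}
    (hbox : ∀ A : Fin n → Set ℝ, (∀ i, MeasurableSet (A i)) → (∀ i, A i ⊆ B) →
      Q ((Set.univ.pi A).indicator fun _ => (1 : ℝ)))
    (hadd : ∀ C D f g, TestOn B C f → TestOn B D g → Q f → Q g → Q fun x => f x + g x)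
    (hmul : ∀ c C f, TestOn B C f → Q f → Q fun x => c * f x)
    (hlim : ∀ (C : ℝ) (F : ℕ → (Fin n → ℝ) → ℝ) (f : (Fin n → ℝ) → ℝ), (∀ j, TestOn B C (F j)) →
      TestOn B C f → (∀ x, Filter.Tendsto (fun j => F j x) Filter.atTop (nhds (f x))) →
      (∀ j, Q (F j)) → Q f)
    {C : ℝ} {f : (Fin n → ℝ) → ℝ} (hf : TestOn B C f) : Q f := by
  have hbm := measurableSet_box (k := n) hB
  have hT : ∀ s : Set (Fin n → ℝ), MeasurableSet s →
      TestOn B 1 ((s ∩ box n B).indicator fun _ => (1 : ℝ)) := fun s hs =>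
    testOn_indicator (hs.inter hbm) Set.inter_subset_right
  have hall : Q ((box n B).indicator fun _ => (1 : ℝ)) := hbox _ (fun _ => hB) fun _ => le_rfl
  have hzero : Q fun _ => 0 := by
    simpa using hmul 0 1 _ (testOn_indicator hbm le_rfl) hall
  have hset : ∀ s : Set (Fin n → ℝ), MeasurableSet s →
      Q ((s ∩ box n B).indicator fun _ => (1 : ℝ)) := by
    refine MeasurableSpace.induction_on_inter generateFrom_pi.symm isPiSystem_pi ?_ ?_ ?_ ?_
    · simpa using hzero
    · rintro _ ⟨A, hA, rfl⟩
      rw [box, ← Set.pi_inter_distrib]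
      have hA : ∀ i, MeasurableSet (A i) := fun i => hA i trivial
      exact hbox _ (fun i => (hA i).inter hB) fun i => Set.inter_subset_right
    · intro t ht hQ
      convert hadd 1 (|(-1)| * 1) _ _ (testOn_indicator hbm le_rfl) ((hT t ht).const_mul (-1)) hall
        (hmul (-1) 1 _ (hT t ht) hQ) using 1
      funext x
      by_cases h1 : x ∈ t <;> by_cases h2 : x ∈ box n B <;> simp [h1, h2]
    · intro s hd hs hQ
      have hU : ∀ j, MeasurableSet (⋃ i < j, s i) := fun j =>
        MeasurableSet.biUnion (Set.to_countable _) fun i _ => hs i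
      -- Partial unions are themselves sets, so their indicators have the common bound 1;
      -- disjointness makes each of them a sum of indicators.
      refine hlim 1 (fun j => ((⋃ i < j, s i) ∩ box n B).indicator fun _ => (1 : ℝ))
        (((⋃ i, s i) ∩ box n B).indicator fun _ => (1 : ℝ)) (fun j => hT _ (hU j)) (hT _ (MeasurableSet.iUnion hs)) (fun x => ?_) fun j => ?_
      · have hiff : ∀ {S T : Set (Fin n → ℝ)}, (x ∈ S ↔ x ∈ T) →
            S.indicator (fun _ => (1 : ℝ)) x = T.indicator (fun _ => (1 : ℝ)) x := fun {S T} h => by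
          by_cases hS : x ∈ S
          · rw [Set.indicator_of_mem hS, Set.indicator_of_mem (h.1 hS)]
          · rw [Set.indicator_of_notMem hS, Set.indicator_of_notMem (mt h.2 hS)]
        refine tendsto_const_nhds.congr' ?_
        by_cases h : x ∈ ⋃ i, s i
        · obtain ⟨i, hi⟩ := Set.mem_iUnion.1 h
          filter_upwards [Filter.eventually_gt_atTop i] with j hj
          have h' : x ∈ ⋃ i < j, s i := Set.mem_biUnion hj hi
          exact hiff (by simp only [Set.mem_inter_iff, h, h'])
        · refine Filter.Eventually.of_forall fun j => ?_
          have h' : x ∉ ⋃ i < j, s i := fun h' => by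
            obtain ⟨i, _, hi⟩ := Set.mem_iUnion₂.1 h'
            exact h (Set.mem_iUnion.2 ⟨i, hi⟩)
          exact hiff (by simp only [Set.mem_inter_iff, h, h'])
      · induction j with
        | zero => simpa using hzero
        | succ j ih =>
          convert hadd 1 1 _ _ (hT _ (hU j)) (hT _ (hs j)) ih (hQ j) using 1
          rw [Set.biUnion_lt_succ, Set.union_inter_distrib_right]
          refine Set.indicator_union_of_disjoint (Disjoint.mono Set.inter_subset_left
            Set.inter_subset_left ?_) _
          exact Set.disjoint_iUnion₂_left.2 fun i hi => hd hi.ne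
  have hsimple : ∀ u : SimpleFunc (Fin n → ℝ) ℝ, (∃ D, TestOn B D ((box n B).indicator u)) ∧
      Q ((box n B).indicator u) := by
    intro u
    induction u using SimpleFunc.induction with
    | const c hs =>
      rename_i s
      have h : (box n B).indicator (SimpleFunc.piecewise s hs (SimpleFunc.const _ c)
          (SimpleFunc.const _ 0)) = fun x => c * (s ∩ box n B).indicator (fun _ => (1 : ℝ)) x := by
        funext x
        by_cases h1 : x ∈ s <;> by_cases h2 : x ∈ box n B <;> simp [h1, h2]
      rw [h]
      exact ⟨⟨_, (hT s hs).const_mul c⟩, hmul c 1 _ (hT s hs) (hset s hs)⟩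
    | add _ hu hv =>
      obtain ⟨⟨D, hD⟩, hu⟩ := hu
      obtain ⟨⟨D', hD'⟩, hv⟩ := hv
      rw [SimpleFunc.coe_add, Set.indicator_add']
      exact ⟨⟨_, hD.add hD'⟩, hadd D D' _ _ hD hD' hu hv⟩
  have hsm := hf.measurable.stronglyMeasurable
  refine hlim C (fun j => (box n B).indicator (hsm.approxBounded C j)) f (fun j => ?_) hf
    (fun x => ?_) fun j => (hsimple _).2
  · refine ⟨(SimpleFunc.measurable _).indicator hbm, fun x => ?_, fun x hx => ?_⟩
    · by_cases h : x ∈ box n B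
      · rw [Set.indicator_of_mem h]
        exact hsm.norm_approxBounded_le hf.nonneg j x
      · rw [Set.indicator_of_notMem h, abs_zero]
        exact hf.nonneg
    · by_contra h
      exact hx (Set.indicator_of_notMem h _)
  · by_cases h : x ∈ box n B
    · simp only [Set.indicator_of_mem h]
      exact hsm.tendsto_approxBounded_of_norm_le (hf.bound x)
    · simp only [Set.indicator_of_notMem h, hf.eq_zero h]
      exact tendsto_const_nhds

/-! ### Sums over tuples: estimates and symmetry -/

theorem abs_injSum_le {X : Type*} {M k : ℕ} {F : (Fin k → X) → ℝ} {C : ℝ} (hC : 0 ≤ C)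
    (hF : ∀ y, |F y| ≤ C) (v : Fin M → X) : |injSum k F v| ≤ C * (M : ℝ) ^ k := by
  refine (Finset.abs_sum_le_sum_abs _ _).trans ((Finset.sum_le_card_nsmul _ _ C
    fun s _ => hF _).trans ?_)
  rw [Finset.card_univ, Fintype.card_embedding_eq, Fintype.card_fin, Fintype.card_fin, nsmul_eq_mul,
    mul_comm]
  gcongr
  exact_mod_cast Nat.descFactorial_le_pow M k

theorem abs_powSum_le {X : Type*} {M k : ℕ} {F : (Fin k → X) → ℝ} {C : ℝ}
    (hF : ∀ y, |F y| ≤ C) (v : Fin M → X) : |powSum k F v| ≤ C * (M : ℝ) ^ k := by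
  refine (Finset.abs_sum_le_sum_abs _ _).trans ((Finset.sum_le_card_nsmul _ _ C
    fun s _ => hF _).trans_eq ?_)
  simp [mul_comm]

theorem powSum_symm {X : Type*} {M n : ℕ} (F : (Fin n → X) → ℝ) (v : Fin M → X) :
    powSum n (symm F) v = powSum n F v := by
  simp only [powSum, symm]
  rw [← Finset.mul_sum, Finset.sum_comm]
  have h : ∀ σ : Equiv.Perm (Fin n), ∑ s : Fin n → Fin M, F (fun i => v (s (σ i))) =
      ∑ s : Fin n → Fin M, F fun i => v (s i) := fun σ =>
    Equiv.sum_comp (Equiv.arrowCongr σ.symm (Equiv.refl (Fin M)))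
      fun s : Fin n → Fin M => F fun i => v (s i)
  have h' : (n ! : ℝ) ≠ 0 := by positivity
  rw [Finset.sum_congr rfl fun σ _ => h σ, Finset.sum_const, Finset.card_univ, Fintype.card_perm,
    Fintype.card_fin, nsmul_eq_mul, ← mul_assoc, inv_mul_cancel₀ h', one_mul]

/-! ### The Meixner polynomials as polynomials -/

/-- The sums over all tuples of fewer than `n` points. -/
def IsLowerSum (B : Set ℝ) (n : ℕ) (H : (Σ M, Fin M → ℝ) → ℝ) : Prop :=
  ∃ u : (k : ℕ) → (Fin k → ℝ) → ℝ, (∀ k, ∃ C, TestOn B C (u k)) ∧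
    ∀ v, H v = ∑ k ∈ Finset.range n, powSum k (u k) v.2

theorem testOn_zero (B : Set ℝ) (n : ℕ) : TestOn B 0 fun _ : Fin n → ℝ => 0 :=
  ⟨measurable_const, fun x => by simp, fun x hx => (hx rfl).elim⟩

namespace IsLowerSum
variable {B : Set ℝ} {n : ℕ} {H K : (Σ M, Fin M → ℝ) → ℝ}

theorem zero : IsLowerSum B n fun _ => 0 :=
  ⟨fun _ _ => 0, fun k => ⟨0, testOn_zero B k⟩, fun v => by simp [powSum]⟩

theorem add (hH : IsLowerSum B n H) (hK : IsLowerSum B n K) :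
    IsLowerSum B n fun v => H v + K v := by
  obtain ⟨u, hu, hH⟩ := hH
  obtain ⟨u', hu', hK⟩ := hK
  refine ⟨fun k y => u k y + u' k y, fun k => ?_, fun v => ?_⟩
  · obtain ⟨C, hC⟩ := hu k
    obtain ⟨D, hD⟩ := hu' k
    exact ⟨_, hC.add hD⟩
  · simp [hH, hK, powSum, Finset.sum_add_distrib]

theorem const_mul (hH : IsLowerSum B n H) (c : ℝ) : IsLowerSum B n fun v => c * H v := by
  obtain ⟨u, hu, hH⟩ := hH
  refine ⟨fun k y => c * u k y, fun k => ?_, fun v => ?_⟩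
  · obtain ⟨C, hC⟩ := hu k
    exact ⟨_, hC.const_mul c⟩
  · simp [hH, powSum, Finset.mul_sum]

theorem sum {κ : Type*} (s : Finset κ) {H : κ → (Σ M, Fin M → ℝ) → ℝ}
    (hH : ∀ i ∈ s, IsLowerSum B n (H i)) : IsLowerSum B n fun v => ∑ i ∈ s, H i v := by
  classical
  induction s using Finset.induction_on with
  | empty => simpa using zero
  | insert a s ha ih =>
    simp only [Finset.sum_insert ha]
    exact (hH a (Finset.mem_insert_self a s)).add
      (ih fun i hi => hH i (Finset.mem_insert_of_mem hi))

theorem powSum {j : ℕ} (hj : j < n) {h : (Fin j → ℝ) → ℝ} {C : ℝ} (hh : TestOn B C h) :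
    IsLowerSum B n fun v => powSum j h v.2 := by
  refine ⟨Function.update (fun _ _ => 0) j h, fun k => ?_, fun v => ?_⟩
  · by_cases hk : k = j
    · subst hk
      exact ⟨C, by simpa using hh⟩
    · exact ⟨0, by simpa [Function.update_of_ne hk] using testOn_zero B k⟩
  · rw [Finset.sum_eq_single j]
    · simp
    · intro k _ hk
      simp [Function.update_of_ne hk, PascalMeixner.powSum]
    · intro hj'
      exact (hj' (Finset.mem_range.2 hj)).elim

theorem of_mem_lowerSums {k : ℕ} {Φ : ((Fin k → ℝ) → ℝ) → (Σ M, Fin M → ℝ) → ℝ}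
    (hΦ : Φ ∈ lowerSums ℝ k n) {h : (Fin k → ℝ) → ℝ} {C : ℝ} (hh : TestOn B C h) :
    IsLowerSum B n (Φ h) := by
  induction hΦ using Submodule.span_induction with
  | mem Φ hΦ =>
    obtain ⟨j, hj, π, hπ, rfl⟩ := hΦ
    exact powSum hj (hh.comp_surjective hπ)
  | zero => exact zero
  | add Φ Ψ _ _ h1 h2 => exact h1.add h2
  | smul c Φ _ h1 => exact h1.const_mul c

theorem injSum_sub_powSum {k : ℕ} (hk : k ≤ n) {h : (Fin k → ℝ) → ℝ} {C : ℝ}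
    (hh : TestOn B C h) :
    IsLowerSum B n fun v => injSum k h v.2 - PascalMeixner.powSum k h v.2 :=
  of_mem_lowerSums (lowerSums_mono ℝ k hk (injSum_sub_powSum_mem ℝ k)) hh

theorem injSum {k : ℕ} (hk : k < n) {h : (Fin k → ℝ) → ℝ} {C : ℝ} (hh : TestOn B C h) :
    IsLowerSum B n fun v => injSum k h v.2 := by
  convert (injSum_sub_powSum hk.le hh).add (powSum hk hh) using 1
  funext v
  simp

end IsLowerSum

/-- The value of the Meixner polynomial at a finite list of points. -/
def pointMeixner (p : ℝ) (α : Measure ℝ) {n : ℕ} (f : (Fin n → ℝ) → ℝ) {M : ℕ} (x : Fin M → ℝ) :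
    ℝ :=
  ∑ k ∈ Finset.range (n + 1), (n.choose k : ℝ) * (1 - 1 / p) ^ ((k : ℤ) - (n : ℤ)) *
    injSum k (family (fun u => ∫ z, u z ∂α) n (symm f) k) x

/-- The term k = n has coefficient 1 and involves the symmetrized f, whose sum over all tuples is
that of f. Replacing distinct tuples by all tuples costs only lower orders. -/
theorem isLowerSum_pointMeixner_sub {α : Measure ℝ} [SFinite α] {B : Set ℝ} (hα : α B ≠ ∞) {n : ℕ}
    {f : (Fin n → ℝ) → ℝ} {C : ℝ} (hf : TestOn B C f) (p : ℝ) :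
    IsLowerSum B n fun v => pointMeixner p α f v.2 - powSum n f v.2 := by
  have h1 : IsLowerSum B n fun v => ∑ k ∈ Finset.range n,
      (n.choose k : ℝ) * (1 - 1 / p) ^ ((k : ℤ) - (n : ℤ)) *
        injSum k (family (fun u => ∫ z, u z ∂α) n (symm f) k) v.2 := by
    refine IsLowerSum.sum _ fun k hk => IsLowerSum.const_mul ?_ _
    have hk := Finset.mem_range.1 hk
    obtain ⟨D, hD⟩ := exists_testOn_family hα n C hk.le
    exact IsLowerSum.injSum hk (hD _ hf.symm)
  convert h1.add (IsLowerSum.injSum_sub_powSum le_rfl hf.symm) using 1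
  funext v
  rw [pointMeixner, Finset.sum_range_succ, family_self, powSum_symm]
  simp
  ring

/-! ### Linearity, continuity and estimates -/

theorem TestOn.integrable_cons {B : Set ℝ} {C : ℝ} {k : ℕ} {F : (Fin (k + 1) → ℝ) → ℝ}
    (hF : TestOn B C F) {α : Measure ℝ} (hα : α B ≠ ∞) (y : Fin k → ℝ) :
    Integrable (fun z => F (Fin.cons z y)) α :=
  TestOn.integrable_of_support hα
    (hF.measurable.comp ((measurable_cons k).comp measurable_prodMk_left)) (fun _ => hF.bound _)
    fun _ hz => (cons_mem_box.1 (hF.support _ hz)).1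

theorem family_add {α : Measure ℝ} [SFinite α] {B : Set ℝ} (hα : α B ≠ ∞) {n : ℕ} {C D : ℝ}
    {f g : (Fin n → ℝ) → ℝ} (hf : TestOn B C f) (hg : TestOn B D g) {k : ℕ} (hk : k ≤ n) :
    family (fun u => ∫ z, u z ∂α) n (fun x => f x + g x) k = fun y =>
      family (fun u => ∫ z, u z ∂α) n f k y + family (fun u => ∫ z, u z ∂α) n g k y := by
  refine descending_induction (Q := fun k => family (fun u => ∫ z, u z ∂α) n
    (fun x => f x + g x) k = fun y => family (fun u => ∫ z, u z ∂α) n f k y +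
      family (fun u => ∫ z, u z ∂α) n g k y) ?_ (fun k hk ih => ?_) hk
  · simp only [family_self]
  · obtain ⟨C', hC'⟩ := exists_testOn_family hα n C hk
    obtain ⟨D', hD'⟩ := exists_testOn_family hα n D hk
    funext y
    rw [family_of_lt _ n _ hk, family_of_lt _ n f hk, family_of_lt _ n g hk, ih]
    simp only [lower]
    rw [integral_add ((hC' f hf).integrable_cons hα y) ((hD' g hg).integrable_cons hα y),
      Finset.sum_add_distrib]
    ring

theorem family_const_mul {α : Measure ℝ} {n : ℕ} (c : ℝ) (f : (Fin n → ℝ) → ℝ) {k : ℕ}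
    (hk : k ≤ n) :
    family (fun u => ∫ z, u z ∂α) n (fun x => c * f x) k = fun y =>
      c * family (fun u => ∫ z, u z ∂α) n f k y := by
  refine descending_induction (Q := fun k => family (fun u => ∫ z, u z ∂α) n
    (fun x => c * f x) k = fun y => c * family (fun u => ∫ z, u z ∂α) n f k y) ?_
    (fun k hk ih => ?_) hk
  · simp only [family_self]
  · funext y
    rw [family_of_lt _ n _ hk, family_of_lt _ n f hk, ih]
    simp only [lower]
    rw [integral_const_mul, mul_add, Finset.mul_sum]

theorem tendsto_family {α : Measure ℝ} [SFinite α] {B : Set ℝ} (hB : MeasurableSet B)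
    (hα : α B ≠ ∞) {n : ℕ} {C : ℝ} {F : ℕ → (Fin n → ℝ) → ℝ} {f : (Fin n → ℝ) → ℝ}
    (hF : ∀ j, TestOn B C (F j))
    (hlim : ∀ x, Filter.Tendsto (fun j => F j x) Filter.atTop (nhds (f x))) {k : ℕ} (hk : k ≤ n) :
    ∀ y, Filter.Tendsto (fun j => family (fun u => ∫ z, u z ∂α) n (F j) k y) Filter.atTop
      (nhds (family (fun u => ∫ z, u z ∂α) n f k y)) := by
  refine descending_induction (Q := fun k => ∀ y, Filter.Tendsto
    (fun j => family (fun u => ∫ z, u z ∂α) n (F j) k y) Filter.atTop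
      (nhds (family (fun u => ∫ z, u z ∂α) n f k y))) ?_ (fun k hk ih => ?_) hk
  · simpa only [family_self] using hlim
  · obtain ⟨C', hC'⟩ := exists_testOn_family hα n C hk
    intro y
    simp only [family_of_lt _ n _ hk, lower]
    refine Filter.Tendsto.add ?_ (tendsto_finsetSum _ fun j _ => ih _)
    refine tendsto_integral_of_dominated_convergence (B.indicator fun _ => C')
      (fun j => ((hC' _ (hF j)).integrable_cons hα y).aestronglyMeasurable) ?_ (fun j => ?_)
      (Filter.Eventually.of_forall fun z => ih _)
    · exact (integrable_indicator_iff hB).2 (integrableOn_const hα)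
    · refine Filter.Eventually.of_forall fun z => ?_
      by_cases hz : z ∈ B
      · rw [Set.indicator_of_mem hz]
        exact (hC' _ (hF j)).bound _
      · rw [Set.indicator_of_notMem hz, (hC' _ (hF j)).eq_zero fun h => hz (TestOn.cons_mem_box.1 h).1,
          norm_zero]

theorem symm_add {n : ℕ} (f g : (Fin n → ℝ) → ℝ) :
    symm (fun x => f x + g x) = fun x => symm f x + symm g x := by
  funext x
  simp only [symm, Finset.sum_add_distrib, mul_add]

theorem symm_const_mul {n : ℕ} (c : ℝ) (f : (Fin n → ℝ) → ℝ) :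
    symm (fun x => c * f x) = fun x => c * symm f x := by
  funext x
  simp only [symm, ← Finset.mul_sum]
  ring

theorem tendsto_symm {n : ℕ} {F : ℕ → (Fin n → ℝ) → ℝ} {f : (Fin n → ℝ) → ℝ}
    (hlim : ∀ x, Filter.Tendsto (fun j => F j x) Filter.atTop (nhds (f x))) (x : Fin n → ℝ) :
    Filter.Tendsto (fun j => symm (F j) x) Filter.atTop (nhds (symm f x)) :=
  (tendsto_finsetSum _ fun _ _ => hlim _).const_mul _

theorem pointMeixner_add {α : Measure ℝ} [SFinite α] {B : Set ℝ} (hα : α B ≠ ∞) {n : ℕ} {C D : ℝ}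
    {f g : (Fin n → ℝ) → ℝ} (hf : TestOn B C f) (hg : TestOn B D g) (p : ℝ) {M : ℕ}
    (x : Fin M → ℝ) :
    pointMeixner p α (fun y => f y + g y) x = pointMeixner p α f x + pointMeixner p α g x := by
  simp only [pointMeixner, ← Finset.sum_add_distrib, ← mul_add]
  refine Finset.sum_congr rfl fun k hk => ?_
  rw [symm_add, family_add hα hf.symm hg.symm (Nat.lt_succ_iff.1 (Finset.mem_range.1 hk)),
    injSum_add]

theorem pointMeixner_const_mul {α : Measure ℝ} {n : ℕ} (c : ℝ) (f : (Fin n → ℝ) → ℝ) (p : ℝ)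
    {M : ℕ} (x : Fin M → ℝ) :
    pointMeixner p α (fun y => c * f y) x = c * pointMeixner p α f x := by
  simp only [pointMeixner, Finset.mul_sum]
  refine Finset.sum_congr rfl fun k hk => ?_
  rw [symm_const_mul, family_const_mul c _ (Nat.lt_succ_iff.1 (Finset.mem_range.1 hk)), injSum_mul]
  ring

theorem tendsto_pointMeixner {α : Measure ℝ} [SFinite α] {B : Set ℝ} (hB : MeasurableSet B)
    (hα : α B ≠ ∞) {n : ℕ} {C : ℝ} {F : ℕ → (Fin n → ℝ) → ℝ} {f : (Fin n → ℝ) → ℝ}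
    (hF : ∀ j, TestOn B C (F j))
    (hlim : ∀ x, Filter.Tendsto (fun j => F j x) Filter.atTop (nhds (f x))) (p : ℝ) {M : ℕ}
    (x : Fin M → ℝ) : Filter.Tendsto (fun j => pointMeixner p α (F j) x) Filter.atTop
      (nhds (pointMeixner p α f x)) :=
  tendsto_finsetSum _ fun _ hk => Filter.Tendsto.const_mul _ (tendsto_finsetSum _ fun _ _ =>
    tendsto_family hB hα (fun j => (hF j).symm) (tendsto_symm hlim)
      (Nat.lt_succ_iff.1 (Finset.mem_range.1 hk)) _)

theorem exists_abs_pointMeixner_le {α : Measure ℝ} [SFinite α] {B : Set ℝ} (hα : α B ≠ ∞) (n : ℕ)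
    (C p : ℝ) : ∃ D, ∀ f : (Fin n → ℝ) → ℝ, TestOn B C f → ∀ (M : ℕ) (x : Fin M → ℝ),
      |pointMeixner p α f x| ≤ D * (1 + (M : ℝ)) ^ n := by
  have h : ∀ k, ∃ C', k ≤ n → ∀ f : (Fin n → ℝ) → ℝ, TestOn B C f →
      TestOn B C' (family (fun u => ∫ z, u z ∂α) n f k) := fun k => by
    by_cases hk : k ≤ n
    · obtain ⟨C', h⟩ := exists_testOn_family hα n C hk
      exact ⟨C', fun _ => h⟩
    · exact ⟨0, fun h => (hk h).elim⟩
  choose C' hC' using h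
  refine ⟨∑ k ∈ Finset.range (n + 1), |(n.choose k : ℝ) * (1 - 1 / p) ^ ((k : ℤ) - (n : ℤ))| * C' k,
    fun f hf M x => ?_⟩
  rw [Finset.sum_mul]
  refine (Finset.abs_sum_le_sum_abs _ _).trans (Finset.sum_le_sum fun k hk => ?_)
  have hk : k ≤ n := Nat.lt_succ_iff.1 (Finset.mem_range.1 hk)
  have ht := hC' k hk _ hf.symm
  have h0 := ht.nonneg
  rw [abs_mul, mul_assoc]
  refine mul_le_mul_of_nonneg_left ((abs_injSum_le h0 ht.bound x).trans ?_) (abs_nonneg _)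
  refine mul_le_mul_of_nonneg_left ?_ h0
  calc (M : ℝ) ^ k ≤ (1 + (M : ℝ)) ^ k := by gcongr; linarith
    _ ≤ (1 + (M : ℝ)) ^ n := pow_le_pow_right₀ (by linarith [Nat.cast_nonneg (α := ℝ) M]) hk

/-! ### Square integrability -/

namespace IsPascalLaw
variable {α : Measure ℝ} {p : ℝ} {ρ : Measure Config}

theorem ae_lists [IsLocallyFiniteMeasure α] (hρ : IsPascalLaw α p ρ) (hp0 : 0 < p) (hp1 : p < 1)
    {B : Set ℝ} (hB : MeasurableSet B) (hα : α B ≠ ∞) :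
    ∀ᵐ μ ∂ρ, SigmaFinite μ.1 ∧ ∃ x : Fin (count B μ) → ℝ, Lists μ B x := by
  filter_upwards [hρ.ae_isLocallyFiniteMeasure hp0 hp1, hρ.ae_eq_count hp0 hp1 hB hα] with μ h1 h2
  refine ⟨inferInstance, ?_⟩
  obtain ⟨M, x, hx⟩ := exists_lists μ hB (by rw [h2]; exact ENNReal.natCast_ne_top _)
  have hM := count_eq (hx.measure_eq hB)
  subst hM
  exact ⟨x, hx⟩

/-- For a rectangle, the monomial is almost surely a product of evaluations. The other test
functions follow by `TestOn.induction_on_boxes`, all identities being finite sums over the list of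
points. -/
theorem aestronglyMeasurable_monomial [IsLocallyFiniteMeasure α] (hρ : IsPascalLaw α p ρ)
    (hp0 : 0 < p) (hp1 : p < 1) {B : Set ℝ} (hB : MeasurableSet B) (hα : α B ≠ ∞) {k : ℕ} {C : ℝ}
    {f : (Fin k → ℝ) → ℝ} (hf : TestOn B C f) : AEStronglyMeasurable (monomial f) ρ := by
  have hL := hρ.ae_lists hp0 hp1 hB hα
  refine TestOn.induction_on_boxes hB (Q := fun f => AEStronglyMeasurable (monomial f) ρ)
    (fun A hA _ => ?_) (fun C D f g hf hg h1 h2 => ?_) (fun c C f hf h => ?_)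
    (fun C F f hF hf hlim h => ?_) hf
  · have hm : Measurable fun μ : Config => ∏ i, (μ.1 (A i)).toReal :=
      Finset.measurable_prod _ fun i _ => (measurable_eval (hA i)).ennreal_toReal
    refine hm.aestronglyMeasurable.congr ?_
    filter_upwards [hL] with μ ⟨h, _⟩
    rw [monomial, integral_indicator_const _ (MeasurableSet.univ_pi hA), Measure.real,
      Measure.pi_pi, ENNReal.toReal_prod, smul_eq_mul, mul_one]
  · refine (h1.add h2).congr ?_
    filter_upwards [hL] with μ ⟨h, x, hx⟩
    rw [Pi.add_apply, hx.monomial_eq hf.support, hx.monomial_eq hg.support,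
      hx.monomial_eq (hf.add hg).support]
    simp [powSum, Finset.sum_add_distrib]
  · refine (h.const_mul c).congr ?_
    filter_upwards [hL] with μ ⟨h, x, hx⟩
    rw [hx.monomial_eq hf.support, hx.monomial_eq (hf.const_mul c).support]
    simp [powSum, Finset.mul_sum]
  · refine aestronglyMeasurable_of_tendsto_ae Filter.atTop h ?_
    filter_upwards [hL] with μ ⟨h, x, hx⟩
    simp only [hx.monomial_eq (hF _).support, hx.monomial_eq hf.support]
    exact tendsto_finsetSum _ fun _ _ => hlim _

theorem ae_abs_monomial_le [IsLocallyFiniteMeasure α] (hρ : IsPascalLaw α p ρ)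
    (hp0 : 0 < p) (hp1 : p < 1) {B : Set ℝ} (hB : MeasurableSet B) (hα : α B ≠ ∞) {k : ℕ} {C : ℝ}
    {f : (Fin k → ℝ) → ℝ} (hf : TestOn B C f) :
    ∀ᵐ μ ∂ρ, |monomial f μ| ≤ C * (1 + (count B μ : ℝ)) ^ k := by
  filter_upwards [hρ.ae_lists hp0 hp1 hB hα] with μ ⟨h, x, hx⟩
  rw [hx.monomial_eq hf.support]
  refine (abs_powSum_le hf.bound x).trans ?_
  have := hf.nonneg
  gcongr
  linarith

theorem memLp_monomial [IsLocallyFiniteMeasure α] (hρ : IsPascalLaw α p ρ)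
    (hp0 : 0 < p) (hp1 : p < 1) {B : Set ℝ} (hB : MeasurableSet B) (hα : α B ≠ ∞) {k : ℕ} {C : ℝ}
    {f : (Fin k → ℝ) → ℝ} (hf : TestOn B C f) : MemLp (monomial f) 2 ρ := by
  have hm := hρ.aestronglyMeasurable_monomial hp0 hp1 hB hα hf
  rw [memLp_two_iff_integrable_sq hm]
  refine Integrable.mono' ((hρ.integrable_count_pow hp0 hp1 hB hα (k * 2)).const_mul (C ^ 2))
    (hm.pow 2) ?_
  filter_upwards [hρ.ae_abs_monomial_le hp0 hp1 hB hα hf] with μ h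
  rw [Real.norm_eq_abs, abs_pow, pow_mul, ← mul_pow]
  gcongr

theorem exists_ae_meixner_eq [IsLocallyFiniteMeasure α] (hρ : IsPascalLaw α p ρ)
    (hp0 : 0 < p) (hp1 : p < 1) {B : Set ℝ} (hB : MeasurableSet B) (hα : α B ≠ ∞) {n : ℕ} {C : ℝ}
    {f : (Fin n → ℝ) → ℝ} (hf : TestOn B C f) :
    ∃ u : (k : ℕ) → (Fin k → ℝ) → ℝ, (∀ k, ∃ C, TestOn B C (u k)) ∧
      ∀ᵐ μ ∂ρ, meixner p α f μ = monomial f μ + ∑ k ∈ Finset.range n, monomial (u k) μ := by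
  obtain ⟨u, hu, h⟩ := isLowerSum_pointMeixner_sub hα hf p
  refine ⟨u, hu, ?_⟩
  filter_upwards [hρ.ae_lists hp0 hp1 hB hα] with μ ⟨_, x, hx⟩
  rw [meixner_eq hB hα hf p hx, hx.monomial_eq hf.support, ← sub_eq_iff_eq_add']
  refine (h ⟨_, x⟩).trans (Finset.sum_congr rfl fun k _ => ?_)
  obtain ⟨D, hD⟩ := hu k
  rw [hx.monomial_eq hD.support]

/-- Measurability in μ is inherited from the representation by monomials, so the kernel formula need
not be examined for it. -/
theorem memLp_meixner [IsLocallyFiniteMeasure α] (hρ : IsPascalLaw α p ρ)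
    (hp0 : 0 < p) (hp1 : p < 1) {B : Set ℝ} (hB : MeasurableSet B) (hα : α B ≠ ∞) {n : ℕ} {C : ℝ}
    {f : (Fin n → ℝ) → ℝ} (hf : TestOn B C f) : MemLp (meixner p α f) 2 ρ := by
  obtain ⟨u, hu, h⟩ := hρ.exists_ae_meixner_eq hp0 hp1 hB hα hf
  have h1 : MemLp (fun μ => ∑ k ∈ Finset.range n, monomial (u k) μ) 2 ρ :=
    memLp_finsetSum _ fun k _ => by
      obtain ⟨D, hD⟩ := hu k
      exact hρ.memLp_monomial hp0 hp1 hB hα hD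
  refine ((hρ.memLp_monomial hp0 hp1 hB hα hf).add h1).ae_eq ?_
  filter_upwards [h] with μ h
  rw [h]
  rfl

/-! ### Orthogonality -/

theorem integrable_grow [IsLocallyFiniteMeasure α] (hρ : IsPascalLaw α p ρ)
    (hp0 : 0 < p) (hp1 : p < 1) {ι : Type} [Fintype ι] {D : ι → Set ℝ}
    (hD : ∀ i, MeasurableSet (D i)) (hd : Pairwise fun i j => Disjoint (D i) (D j))
    (hα : ∀ i, α (D i) ≠ ∞) {H : (ι → ℕ) → ℝ} (hH : Grow H) :
    Integrable (fun μ => H fun i => count (D i) μ) ρ := by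
  obtain ⟨C, d, h⟩ := hH
  have hU : α (⋃ i, D i) ≠ ∞ := by
    rw [measure_iUnion hd hD, tsum_fintype]
    exact ENNReal.sum_ne_top.2 fun i _ => hα i
  refine Integrable.mono' ((hρ.integrable_count_pow hp0 hp1 (MeasurableSet.iUnion hD) hU d).const_mul
    C) ((measurable_of_countable H).comp (measurable_counts hD)).aestronglyMeasurable ?_
  filter_upwards [hρ.ae_sum_count hp0 hp1 hD hd hα] with μ hμ
  rw [← hμ]
  push_cast
  exact h _

/-- On the box the integrand is constant on each cell, so integration against α becomes the finite
sum weighted by the α-measures of the cells. Both sides agree only for points in B, hence the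
restriction on y. -/
theorem family_eq_of_cells {B : Set ℝ} (hB : MeasurableSet B) [SFinite α] (hα : α B ≠ ∞)
    {ι : Type} [Fintype ι] {c : ℝ → ι} (hc : ∀ i, MeasurableSet (c ⁻¹' {i})) {n : ℕ} {C : ℝ}
    {f : (Fin n → ℝ) → ℝ} (hf : TestOn B C f) {F : (Fin n → ι) → ℝ}
    (hF : ∀ y ∈ box n B, f y = F fun i => c (y i)) {k : ℕ} (hk : k ≤ n) :
    ∀ y ∈ box k B, family (fun u => ∫ z, u z ∂α) n f k y =
      family (fun u : ι → ℝ => ∑ i, (α (B ∩ c ⁻¹' {i})).toReal * u i) n F k fun i => c (y i) := by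
  refine descending_induction (Q := fun k => ∀ y ∈ box k B, family (fun u => ∫ z, u z ∂α) n f k y =
      family (fun u : ι → ℝ => ∑ i, (α (B ∩ c ⁻¹' {i})).toReal * u i) n F k fun i => c (y i)) ?_
    (fun k hk ih => ?_) hk
  · simpa only [family_self] using hF
  · intro y hy
    obtain ⟨C', hC'⟩ := exists_testOn_family hα n C hk
    have ht := hC' f hf
    have hcons : ∀ z ∈ B, family (fun u => ∫ z, u z ∂α) n f (k + 1) (Fin.cons z y) =
        family (fun u : ι → ℝ => ∑ i, (α (B ∩ c ⁻¹' {i})).toReal * u i) n F (k + 1)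
          (Fin.cons (c z) fun i => c (y i)) := fun z hz => by
      rw [ih _ (TestOn.cons_mem_box.2 ⟨hz, hy⟩), cons_comp_apply]
    rw [family_of_lt _ n f hk, family_of_lt _ n F hk]
    simp only [lower]
    congr 1
    · rw [← setIntegral_eq_integral_of_forall_compl_eq_zero (s := B) fun z hz =>
        ht.eq_zero fun h => hz (TestOn.cons_mem_box.1 h).1]
      have hU : B = ⋃ i, B ∩ c ⁻¹' {i} := by
        ext z
        simp
      conv_lhs => rw [hU]
      rw [integral_iUnion_fintype (fun i => hB.inter (hc i))
        (fun i j hij => Set.disjoint_left.2 fun z hi hj => hij (hi.2.symm.trans hj.2))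
        fun i => (ht.integrable_cons hα y).integrableOn]
      refine Finset.sum_congr rfl fun i _ => ?_
      rw [setIntegral_congr_fun (hB.inter (hc i)) fun z hz => by
        rw [hcons z hz.1, show c z = i from hz.2], setIntegral_const]
      rfl
    · exact Finset.sum_congr rfl fun j _ => hcons _ (mem_box.1 hy j)

theorem integral_meixner_mul_monomial_of_cells [IsLocallyFiniteMeasure α] (hρ : IsPascalLaw α p ρ)
    (hp0 : 0 < p) (hp1 : p < 1) {B : Set ℝ} (hB : MeasurableSet B) (hα : α B ≠ ∞)
    {ι : Type} [Fintype ι] {c : ℝ → ι} (hc : ∀ i, MeasurableSet (c ⁻¹' {i})) {m n : ℕ} (hmn : m < n)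
    {C C' : ℝ} {f : (Fin n → ℝ) → ℝ} {g : (Fin m → ℝ) → ℝ} (hf : TestOn B C f) (hg : TestOn B C' g)
    {F : (Fin n → ι) → ℝ} {G : (Fin m → ι) → ℝ} (hF : ∀ y ∈ box n B, f y = F fun i => c (y i))
    (hG : ∀ y ∈ box m B, g y = G fun i => c (y i)) :
    ∫ μ, meixner p α f μ * monomial g μ ∂ρ = 0 := by
  classical
  set D : ι → Set ℝ := fun i => B ∩ c ⁻¹' {i} with hDdef
  have hD : ∀ i, MeasurableSet (D i) := fun i => hB.inter (hc i)
  have hd : Pairwise fun i j => Disjoint (D i) (D j) := fun i j hij =>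
    Set.disjoint_left.2 fun z hi hj => hij (hi.2.symm.trans hj.2)
  have hαD : ∀ i, α (D i) ≠ ∞ := fun i => measure_ne_top_of_subset Set.inter_subset_left hα
  set a : ι → ℝ := fun i => (α (D i)).toReal with ha
  set Γ := family (fun u : ι → ℝ => ∑ i, a i * u i) n (symm F)
  have hΓ : ∀ k ≤ n, ∀ y ∈ box k B, family (fun u => ∫ z, u z ∂α) n (symm f) k y =
      Γ k fun i => c (y i) := fun k hk =>
    family_eq_of_cells hB hα hc hf.symm (fun y hy => by
      simp only [symm]
      congr 1
      refine Finset.sum_congr rfl fun s _ => hF _ ?_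
      exact mem_box.2 fun i => mem_box.1 hy (s i)) hk
  have hH : Grow fun N => meixnerSum p n Γ N * monSum m G N :=
    (grow_meixnerSum p n Γ).mul (grow_monSum m G)
  have hae : ∀ᵐ μ ∂ρ, meixner p α f μ * monomial g μ =
      (fun N => meixnerSum p n Γ N * monSum m G N) fun i => count (D i) μ := by
    filter_upwards [hρ.ae_lists hp0 hp1 hB hα] with μ ⟨_, x, hx⟩
    have hN : ∀ i, Fintype.card {t // c (x t) = i} = count (D i) μ := fun i => by
      rw [count_eq (hx.measure_eq_card (hD i) Set.inter_subset_left), Nat.card_eq_fintype_card]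
      exact Fintype.card_congr (Equiv.subtypeEquivRight fun t => by simp [hDdef, hx.mem t])
    rw [meixner_eq hB hα hf p hx, hx.monomial_eq hg.support]
    congr 1
    · refine Finset.sum_congr rfl fun k hk => ?_
      rw [← injSum_eq_facSum k (Γ k) (fun t => c (x t)) _ hN]
      congr 1
      exact Finset.sum_congr rfl fun e _ => hΓ k (Nat.lt_succ_iff.1 (Finset.mem_range.1 hk)) _
        (mem_box.2 fun i => hx.mem _)
    · rw [← powSum_eq_monSum m G (fun t => c (x t)) _ hN]
      exact Finset.sum_congr rfl fun e _ => hG _ (mem_box.2 fun i => hx.mem _)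
  rw [integral_congr_ae hae, hρ.integral_counts hD (hρ.integrable_grow hp0 hp1 hD hd hαD hH)]
  exact tsum_meixnerSum_mul_eq_zero hp0 hp1 n (hρ.isPascalWeight hp0 hp1 hD hd hαD)
    (symmFamily_family _ (symm_comp_perm F)) (loweringFamily_family a _) (grow_monSum m G)
    -- A monomial of degree m is killed by m + 1 differences, and m < n means m + 1 ≤ n.
    ((degLT_monSum m G).mono hmn)

theorem integral_meixner_mul_monomial_of_boxes [IsLocallyFiniteMeasure α] (hρ : IsPascalLaw α p ρ)
    (hp0 : 0 < p) (hp1 : p < 1) {B : Set ℝ} (hB : MeasurableSet B) (hα : α B ≠ ∞) {m n : ℕ}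
    (hmn : m < n) {A : Fin n → Set ℝ} {A' : Fin m → Set ℝ} (hA : ∀ i, MeasurableSet (A i))
    (hA' : ∀ i, MeasurableSet (A' i)) (hAB : ∀ i, A i ⊆ B) (hAB' : ∀ i, A' i ⊆ B) :
    ∫ μ, meixner p α ((Set.univ.pi A).indicator fun _ => (1 : ℝ)) μ *
      monomial ((Set.univ.pi A').indicator fun _ => (1 : ℝ)) μ ∂ρ = 0 := by
  classical
  -- The cells are the atoms of the algebra generated by all sides of both rectangles: z is labelled
  -- by the sides that contain it.
  have hc : Measurable fun (z : ℝ) (j : Fin n ⊕ Fin m) => decide (z ∈ Sum.elim A A' j) := by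
    refine measurable_pi_lambda _ fun j => measurable_to_bool ?_
    have : MeasurableSet (Sum.elim A A' j) := by
      cases j
      · exact hA _
      · exact hA' _
    convert this using 1
    ext z
    simp
  refine hρ.integral_meixner_mul_monomial_of_cells hp0 hp1 hB hα
    (c := fun (z : ℝ) (j : Fin n ⊕ Fin m) => decide (z ∈ Sum.elim A A' j))
    (fun i => hc (measurableSet_singleton i)) hmn
    (testOn_indicator (MeasurableSet.univ_pi hA) (Set.pi_mono fun i _ => hAB i))
    (testOn_indicator (MeasurableSet.univ_pi hA') (Set.pi_mono fun i _ => hAB' i))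
    (F := fun s => if ∀ i, s i (Sum.inl i) = true then 1 else 0)
    (G := fun s => if ∀ i, s i (Sum.inr i) = true then 1 else 0) (fun y _ => ?_) fun y _ => ?_
  · by_cases h : y ∈ Set.univ.pi A
    · rw [Set.indicator_of_mem h]
      exact (if_pos fun i => decide_eq_true (h i trivial)).symm
    · rw [Set.indicator_of_notMem h]
      exact (if_neg fun h' => h fun i _ => of_decide_eq_true (h' i)).symm
  · by_cases h : y ∈ Set.univ.pi A'
    · rw [Set.indicator_of_mem h]
      exact (if_pos fun i => decide_eq_true (h i trivial)).symm
    · rw [Set.indicator_of_notMem h]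
      exact (if_neg fun h' => h fun i _ => of_decide_eq_true (h' i)).symm

/-- The Meixner polynomials of degree `n` are orthogonal to the monomials of smaller degree. -/
theorem integral_meixner_mul_monomial [IsLocallyFiniteMeasure α] (hρ : IsPascalLaw α p ρ)
    (hp0 : 0 < p) (hp1 : p < 1) {B : Set ℝ} (hB : MeasurableSet B) (hα : α B ≠ ∞) {m n : ℕ}
    (hmn : m < n) {C C' : ℝ} {f : (Fin n → ℝ) → ℝ} {g : (Fin m → ℝ) → ℝ} (hf : TestOn B C f)
    (hg : TestOn B C' g) : ∫ μ, meixner p α f μ * monomial g μ ∂ρ = 0 := by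
  have hL := hρ.ae_lists hp0 hp1 hB hα
  have hint : ∀ {C C'} {f : (Fin n → ℝ) → ℝ} {g : (Fin m → ℝ) → ℝ}, TestOn B C f → TestOn B C' g →
      Integrable (fun μ => meixner p α f μ * monomial g μ) ρ := fun hf hg =>
    (hρ.memLp_meixner hp0 hp1 hB hα hf).integrable_mul (hρ.memLp_monomial hp0 hp1 hB hα hg)
  -- One dominating function for all f and g with given bounds, as dominated convergence along the
  -- approximating sequences requires.
  have hbound : ∀ C C', ∃ D, ∀ (f : (Fin n → ℝ) → ℝ) (g : (Fin m → ℝ) → ℝ), TestOn B C f →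
      TestOn B C' g → ∀ᵐ μ ∂ρ, ‖meixner p α f μ * monomial g μ‖ ≤
        D * (1 + (count B μ : ℝ)) ^ (n + m) := fun C C' => by
    obtain ⟨D, hD⟩ := exists_abs_pointMeixner_le hα n C p
    refine ⟨D * C', fun f g hf hg => ?_⟩
    filter_upwards [hL, hρ.ae_abs_monomial_le hp0 hp1 hB hα hg] with μ ⟨_, x, hx⟩ hμ
    have h1 := hD f hf _ x
    rw [Real.norm_eq_abs, abs_mul, meixner_eq hB hα hf p hx, pow_add, mul_mul_mul_comm]
    exact mul_le_mul h1 hμ (abs_nonneg _) ((abs_nonneg _).trans h1)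
  -- Two nested monotone class arguments: first in g for arbitrary f, then in f with g the indicator
  -- of a rectangle.
  refine TestOn.induction_on_boxes hB
    (Q := fun g => ∫ μ, meixner p α f μ * monomial g μ ∂ρ = 0) (fun A' hA' hAB' => ?_)
    (fun C D g h hg hh h1 h2 => ?_) (fun c C g hg h => ?_) (fun C₁ F g hF hg hlim h => ?_) hg
  · have hg' := testOn_indicator (MeasurableSet.univ_pi hA') (Set.pi_mono fun i _ => hAB' i)
    refine TestOn.induction_on_boxes hB (Q := fun f => ∫ μ, meixner p α f μ *
      monomial ((Set.univ.pi A').indicator fun _ => (1 : ℝ)) μ ∂ρ = 0) (fun A hA hAB => ?_)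
      (fun C D f h hf hh h1 h2 => ?_) (fun c C f hf h => ?_) (fun C₁ F f hF hf hlim h => ?_) hf
    · exact hρ.integral_meixner_mul_monomial_of_boxes hp0 hp1 hB hα hmn hA hA' hAB hAB'
    · have h3 := integral_add (hint hf hg') (hint hh hg')
      rw [h1, h2, add_zero] at h3
      refine (integral_congr_ae ?_).trans h3
      filter_upwards [hL] with μ ⟨_, x, hx⟩
      rw [meixner_eq hB hα hf p hx, meixner_eq hB hα hh p hx, meixner_eq hB hα (hf.add hh) p hx,
        ← add_mul]
      congr 1
      exact pointMeixner_add hα hf hh p x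
    · have h3 := congrArg (c * ·) h
      rw [← integral_const_mul, mul_zero] at h3
      refine (integral_congr_ae ?_).trans h3
      filter_upwards [hL] with μ ⟨_, x, hx⟩
      rw [meixner_eq hB hα hf p hx, meixner_eq hB hα (hf.const_mul c) p hx, ← mul_assoc]
      congr 1
      exact pointMeixner_const_mul c f p x
    · obtain ⟨D, hD⟩ := hbound C₁ 1
      refine tendsto_nhds_unique (tendsto_integral_of_dominated_convergence _
        (fun j => (hint (hF j) hg').aestronglyMeasurable)
        ((hρ.integrable_count_pow hp0 hp1 hB hα (n + m)).const_mul D)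
        (fun j => hD _ _ (hF j) hg') ?_) (tendsto_const_nhds.congr fun j => (h j).symm)
      filter_upwards [hL] with μ ⟨_, x, hx⟩
      simp only [meixner_eq hB hα (hF _) p hx, meixner_eq hB hα hf p hx]
      exact (tendsto_pointMeixner hB hα hF hlim p x).mul_const _
  · have h3 := integral_add (hint hf hg) (hint hf hh)
    rw [h1, h2, add_zero] at h3
    refine (integral_congr_ae ?_).trans h3
    filter_upwards [hL] with μ ⟨_, x, hx⟩
    rw [hx.monomial_eq hg.support, hx.monomial_eq hh.support, hx.monomial_eq (hg.add hh).support,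
      ← mul_add]
    simp [powSum, Finset.sum_add_distrib]
  · have h3 := congrArg (c * ·) h
    rw [← integral_const_mul, mul_zero] at h3
    refine (integral_congr_ae ?_).trans h3
    filter_upwards [hL] with μ ⟨_, x, hx⟩
    rw [hx.monomial_eq hg.support, hx.monomial_eq (hg.const_mul c).support, mul_left_comm]
    simp [powSum, Finset.mul_sum]
  · obtain ⟨D, hD⟩ := hbound C C₁
    refine tendsto_nhds_unique (tendsto_integral_of_dominated_convergence _
      (fun j => (hint hf (hF j)).aestronglyMeasurable)
      ((hρ.integrable_count_pow hp0 hp1 hB hα (n + m)).const_mul D)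
      (fun j => hD _ _ hf (hF j)) ?_) (tendsto_const_nhds.congr fun j => (h j).symm)
    filter_upwards [hL] with μ ⟨_, x, hx⟩
    simp only [hx.monomial_eq (hF _).support, hx.monomial_eq hg.support]
    exact (tendsto_finsetSum _ fun _ _ => hlim _).const_mul _

end IsPascalLaw

/-! ### The orthogonal projection -/

theorem IsTest.exists_testOn {n : ℕ} {f : (Fin n → ℝ) → ℝ} (hf : IsTest f) :
    ∃ R C : ℝ, TestOn (Set.Icc (-R) R) C f := by
  obtain ⟨hm, ⟨C, hC⟩, hb⟩ := hf
  obtain ⟨R, hR⟩ := hb.subset_closedBall 0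
  refine ⟨R, C, hm, hC, fun x hx => mem_box.2 fun i => ?_⟩
  have h1 : ‖x‖ ≤ R := by simpa using hR hx
  exact abs_le.1 ((norm_le_pi_norm x i).trans h1)

theorem TestOn.isTest {n : ℕ} {f : (Fin n → ℝ) → ℝ} {R C : ℝ}
    (hf : TestOn (Set.Icc (-R) R) C f) : IsTest f :=
  ⟨hf.measurable, ⟨C, hf.bound⟩,
    (Bornology.IsBounded.pi fun _ => Metric.isBounded_Icc (-R) R).subset hf.support⟩

theorem monomial_zero (f : (Fin 0 → ℝ) → ℝ) (μ : Config) : monomial f μ = f Fin.elim0 := by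
  rw [monomial, Measure.pi_of_empty _ Fin.elim0, integral_dirac]

theorem monomial_const_mul {k : ℕ} (c : ℝ) (f : (Fin k → ℝ) → ℝ) (μ : Config) :
    monomial (fun y => c * f y) μ = c * monomial f μ :=
  integral_const_mul _ _

theorem sum_range_monomial {n : ℕ} (hn : 1 ≤ n) (u : (k : ℕ) → (Fin k → ℝ) → ℝ) (μ : Config) :
    ∑ k ∈ Finset.range n, monomial (u k) μ =
      u 0 Fin.elim0 + ∑ k ∈ Finset.Icc 1 (n - 1), monomial (u k) μ := by
  obtain ⟨n, rfl⟩ := Nat.exists_eq_add_of_le' hn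
  rw [Finset.range_eq_Ico, Finset.sum_eq_sum_Ico_succ_bot (by omega), monomial_zero]
  rfl

namespace IsPascalLaw
variable {α : Measure ℝ} {p : ℝ} {ρ : Measure Config}

theorem integral_meixner_mul_monomial_of_isTest [IsLocallyFiniteMeasure α]
    (hρ : IsPascalLaw α p ρ) (hp0 : 0 < p) (hp1 : p < 1) {m n : ℕ} (hmn : m < n)
    {f : (Fin n → ℝ) → ℝ} {g : (Fin m → ℝ) → ℝ} (hf : IsTest f) (hg : IsTest g) :
    ∫ μ, meixner p α f μ * monomial g μ ∂ρ = 0 := by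
  obtain ⟨R, C, hf⟩ := hf.exists_testOn
  obtain ⟨R', C', hg⟩ := hg.exists_testOn
  refine hρ.integral_meixner_mul_monomial hp0 hp1 (B := Set.Icc (-(max R R')) (max R R'))
    measurableSet_Icc isCompact_Icc.measure_ne_top hmn (hf.mono ?_ le_rfl) (hg.mono ?_ le_rfl)
  · exact Set.Icc_subset_Icc (neg_le_neg (le_max_left _ _)) (le_max_left _ _)
  · exact Set.Icc_subset_Icc (neg_le_neg (le_max_right _ _)) (le_max_right _ _)

theorem memLp_monomial_of_isTest [IsLocallyFiniteMeasure α] (hρ : IsPascalLaw α p ρ)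
    (hp0 : 0 < p) (hp1 : p < 1) {n : ℕ} {f : (Fin n → ℝ) → ℝ} (hf : IsTest f) :
    MemLp (monomial f) 2 ρ := by
  obtain ⟨R, C, hf⟩ := hf.exists_testOn
  exact hρ.memLp_monomial hp0 hp1 measurableSet_Icc isCompact_Icc.measure_ne_top hf

theorem memLp_meixner_of_isTest [IsLocallyFiniteMeasure α] (hρ : IsPascalLaw α p ρ)
    (hp0 : 0 < p) (hp1 : p < 1) {n : ℕ} {f : (Fin n → ℝ) → ℝ} (hf : IsTest f) :
    MemLp (meixner p α f) 2 ρ := by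
  obtain ⟨R, C, hf⟩ := hf.exists_testOn
  exact hρ.memLp_meixner hp0 hp1 measurableSet_Icc isCompact_Icc.measure_ne_top hf

/-- The Meixner polynomials of degree `n` are orthogonal to the polynomials of smaller degree. -/
theorem toLp_meixner_mem_orthogonal [IsLocallyFiniteMeasure α] (hρ : IsPascalLaw α p ρ)
    (hp0 : 0 < p) (hp1 : p < 1) {n : ℕ} (hn : 1 ≤ n) {f : (Fin n → ℝ) → ℝ} (hf : IsTest f) :
    (hρ.memLp_meixner_of_isTest hp0 hp1 hf).toLp ∈ (polynomials ρ (n - 1))ᗮ := by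
  have hM := hρ.memLp_meixner_of_isTest hp0 hp1 hf
  rw [Submodule.mem_orthogonal]
  intro G hG
  induction hG using Submodule.span_induction with
  | zero => exact inner_zero_left _
  | add G H _ _ h1 h2 => rw [inner_add_left, h1, h2, add_zero]
  | smul c G _ h => rw [inner_smul_left, h, mul_zero]
  | mem G hG =>
    obtain ⟨F, ⟨c, u, hu, hF⟩, hG⟩ := hG
    -- The constant term is treated as a monomial of degree 0, which is below n because 1 ≤ n.
    have hc : IsTest fun _ : Fin 0 → ℝ => c :=
      ⟨measurable_const, ⟨|c|, fun _ => le_rfl⟩, (Set.toFinite _).isBounded⟩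
    have hint : ∀ {k : ℕ} {g : (Fin k → ℝ) → ℝ}, IsTest g →
        Integrable (fun μ => meixner p α f μ * monomial g μ) ρ := fun hg =>
      hM.integrable_mul (hρ.memLp_monomial_of_isTest hp0 hp1 hg)
    have hae : (fun μ => inner ℝ (G μ) ((hM.toLp : Lp ℝ 2 ρ) μ)) =ᵐ[ρ] fun μ =>
        meixner p α f μ * monomial (fun _ : Fin 0 → ℝ => c) μ +
          ∑ k ∈ Finset.Icc 1 (n - 1), meixner p α f μ * monomial (u k) μ := by
      filter_upwards [hG, hM.coeFn_toLp, hρ.ae_isLocallyFiniteMeasure hp0 hp1] with μ h1 h2 h3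
      rw [h1, h2, hF μ h3, monomial_zero, ← Finset.mul_sum, ← mul_add]
      rfl
    rw [L2.inner_def, integral_congr_ae hae, integral_add (hint hc)
      (integrable_finsetSum _ fun k _ => hint (hu k)),
      integral_finsetSum _ fun k _ => hint (hu k),
      hρ.integral_meixner_mul_monomial_of_isTest hp0 hp1 (by omega) hf hc, zero_add]
    refine Finset.sum_eq_zero fun k hk => ?_
    have := Finset.mem_Icc.1 hk
    exact hρ.integral_meixner_mul_monomial_of_isTest hp0 hp1 (by omega) hf (hu k)

/-- The Meixner polynomial of degree `n` differs from the monomial by a polynomial of smaller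
degree. -/
theorem toLp_monomial_sub_toLp_meixner_mem [IsLocallyFiniteMeasure α] (hρ : IsPascalLaw α p ρ)
    (hp0 : 0 < p) (hp1 : p < 1) {n : ℕ} (hn : 1 ≤ n) {f : (Fin n → ℝ) → ℝ} (hf : IsTest f) :
    (hρ.memLp_monomial_of_isTest hp0 hp1 hf).toLp - (hρ.memLp_meixner_of_isTest hp0 hp1 hf).toLp ∈
      polynomials ρ (n - 1) := by
  have h1 := hρ.memLp_monomial_of_isTest hp0 hp1 hf
  have h2 := hρ.memLp_meixner_of_isTest hp0 hp1 hf
  obtain ⟨R, C, hf⟩ := hf.exists_testOn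
  obtain ⟨u, hu, h⟩ := hρ.exists_ae_meixner_eq hp0 hp1 measurableSet_Icc
    isCompact_Icc.measure_ne_top hf
  refine Submodule.subset_span ⟨fun μ => -u 0 Fin.elim0 + ∑ k ∈ Finset.Icc 1 (n - 1),
    monomial (fun y => -1 * u k y) μ, ⟨_, _, fun k => ?_, fun μ _ => rfl⟩, ?_⟩
  · obtain ⟨D, hD⟩ := hu k
    exact (hD.const_mul (-1)).isTest
  · filter_upwards [Lp.coeFn_sub h1.toLp h2.toLp, h1.coeFn_toLp, h2.coeFn_toLp, h] with μ a b c d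
    rw [a, Pi.sub_apply, b, c, d, sum_range_monomial hn]
    simp only [monomial_const_mul, ← Finset.mul_sum]
    ring

/-- The monomial splits into a part in the orthogonal complement and a polynomial of lower degree.
The span of polynomials need not be closed; it suffices that it lies in its double orthogonal
complement. -/
theorem meixner_ae_eq_starProjection [IsLocallyFiniteMeasure α] (hρ : IsPascalLaw α p ρ)
    (hp0 : 0 < p) (hp1 : p < 1) {n : ℕ} (hn : 1 ≤ n) {f : (Fin n → ℝ) → ℝ} (hf : IsTest f) :
    ∃ h : MemLp (monomial f) 2 ρ,
      meixner p α f =ᵐ[ρ] (polynomials ρ (n - 1))ᗮ.starProjection h.toLp := by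
  refine ⟨hρ.memLp_monomial_of_isTest hp0 hp1 hf, ?_⟩
  have h := Submodule.eq_starProjection_of_mem_orthogonal (K := (polynomials ρ (n - 1))ᗮ)
    (hρ.toLp_meixner_mem_orthogonal hp0 hp1 hn hf) (Submodule.le_orthogonal_orthogonal _
      (hρ.toLp_monomial_sub_toLp_meixner_mem hp0 hp1 hn hf))
  rw [h]
  exact (hρ.memLp_meixner_of_isTest hp0 hp1 hf).coeFn_toLp.symm

end IsPascalLaw

end PascalMeixner

end

/-! ### Multiples of Lebesgue measure -/

theorem mainTheorem4 (θ : ℝ) (hθ : 0 < θ) (p : ℝ) (hp0 : 0 < p) (hp1 : p < 1)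
    (ρ : Measure PascalMeixner.Config)
    (hρ : PascalMeixner.IsPascalLaw (ENNReal.ofReal θ • (volume : Measure ℝ)) p ρ)
    (n : ℕ) (hn : 1 ≤ n) (f : (Fin n → ℝ) → ℝ) (hf : PascalMeixner.IsTest f) :
    ∃ h : MemLp (PascalMeixner.monomial f) 2 ρ,
      PascalMeixner.meixner p (ENNReal.ofReal θ • (volume : Measure ℝ)) f =ᵐ[ρ]
        (PascalMeixner.polynomials ρ (n - 1))ᗮ.starProjection h.toLp := by
  -- Local finiteness is the only property of α that the argument uses; the scalar is the coercion
  -- of θ.toNNReal, for which the instance is available.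
  have : IsLocallyFiniteMeasure (ENNReal.ofReal θ • (volume : Measure ℝ)) :=
    inferInstanceAs (IsLocallyFiniteMeasure (θ.toNNReal • (volume : Measure ℝ)))
  exact hρ.meixner_ae_eq_starProjection hp0 hp1 hn hf
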